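/- **Setting.** Let $(c_{k,l})_{k,l=1}^r$ be a generalized Cartan matrix and let $\mathfrak g$ be the complex Lie algebra with generators $e_k,f_k,\check\alpha_k$ $(1\le k\le r)$ and relations $[e_k,f_l]=\delta_{kl}\check\alpha_k$, $[\check\alpha_k,\check\alpha_l]=0$, $[\check\alpha_k,e_l]=c_{k,l}e_l$, $[\check\alpha_k,f_l]=-c_{k,l}f_l$, and, for $k\ne l$, $\mathrm{ad}(e_k)^{1-c_{k,l}}e_l=0=\mathrm{ad}(f_k)^{1-c_{k,l}}f_l$. It is graded by the root lattice $\bigoplus_k\mathbb Z\alpha_k$ ($e_k$, $f_k$, $\check\alpha_k$ having degree $\alpha_k$, $-\alpha_k$, $0$); a root is a nonzero $\alpha$ with $\mathfrak g_\alpha\neq0$. If $\mathfrak g$ is simple and finite dimensional, its highest root $\tilde\alpha$ is the positive root such that no $\tilde\alpha+\alpha_k$ is a root. Let $\lambda_1,\dots,\lambda_n$ be dominant weights, i.e. $\lambda_\nu(\check\alpha_k)\in\mathbb R_{\ge0}$. Let $\mathcal I$ be a countable set with a map $\pi:\mathcal I\to\{1,\dots,r\}$, $i\mapsto\bar i$,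 all of whose fibres are infinite. For a sequence $S$ in $\mathcal I$ we write $\bar S$ for its image and $\alpha_{\bar S}:=\sum_{s}\alpha_{\bar s}$, the sum being over the terms of $S$. We consider (possibly infinite sums of) rational polydifferentials $g\,dt_{x_1}\cdots dt_{x_d}$ in variables $t_i$ $(i\in\mathcal I)$, relative to parameters $z_1,\dots,z_n$; the $dt_i$ commute and have square zero. For a sequence $I=(i_N,\dots,i_1)$ in $\mathcal I$ put $$\zeta_I(z)=\frac{dt_{i_N}\cdots dt_{i_1}}{(t_{i_N}-t_{i_{N-1}})\cdots(t_{i_2}-t_{i_1})(t_{i_1}-z)},$$ and for an $n$-tuple $\mathbf S=(S^1,\dots,S^n)$ of sequences in $\{1,\dots,r\}$ let $\zeta(\mathbf S)$ be the sum of the products $\zeta_{I^1}(z_1)\cdots\zeta_{I^n}(z_n)$ over all $(I^1,\dots,I^n)$ with $\bar I^\nu=S^\nu$ whose juxtaposition is without repetition. The $\zeta(\mathbf S)$ are linearly independent; $\tilde V(\boldsymbol\lambda)$ is their span. The operator $e_k$ on $\tilde V(\boldsymbol\lambda)$ sends $\zeta(\mathbf S)$ to the sum, over those $\nu$ for which $S^\nu$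 begins with $k$, of the elements obtained by deleting this first term of $S^\nu$; an element is primitive if all $e_k$ kill it. For one parameter $z$ and a weight $\lambda$ let $$f_k=\sum_{\bar i=k}dt_i\Big(\frac{\lambda(\check\alpha_k)}{t_i-z}-\sum_{j\ne i}\frac{c_{k,\bar j}}{t_i-t_j}\,dt_j\,\iota_{\partial/\partial t_j}\Big),$$ let $V(\lambda)$ be the smallest linear subspace that contains $1$ and is stable under $f_1,\dots,f_r$, and let $V(\boldsymbol\lambda)=V(\lambda_1)\otimes\cdots\otimes V(\lambda_n)$ be the span of the products $\zeta_1(z_1)\cdots\zeta_n(z_n)$ with $\zeta_\nu\in V(\lambda_\nu)$. For $I=(i_N,\dots,i_1)$ without repetition let $\mathrm{res}_I=\mathrm{res}_{(t_{i_2}\to t_{i_1})}\cdots\mathrm{res}_{(t_{i_N}\to t_{i_{N-1}})}$ (the identity if $N=1$), where $\mathrm{res}_{(t_x\to t_y)}$ is the residue in the $t_x$-direction at $t_x=t_y$; write $t_{\{I\}}$ for the coordinate $t_{i_1}$ on the locus $t_{i_1}=\cdots=t_{i_N}$. For a polydifferential $\omega$, $\omega_{\mathcal I-\{I\}}$ denotes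 the sum of its components that involve no $dt_i$ with $i\in\{I\}$. **Theorem.** Let $I=(i_N,\dots,i_1)$, $N\ge1$, be a sequence in $\mathcal I$ without repetition. 1. If $\mathrm{res}_I$ is nonzero on $V(\boldsymbol\lambda)$, then for every nonempty initial part $J=(i_N,\dots,i_m)$ of $I$ the weight $\alpha_{\bar J}$ is a root. 2. Suppose that $\mathfrak g$ is simple and finite dimensional and that $\alpha_{\bar I}$ is the highest root. Then for every $\zeta\in V(\boldsymbol\lambda)$ the poles of $\mathrm{res}_I\zeta$ that involve the coordinate $t_{\{I\}}$ occur only where $t_{\{I\}}$ takes a value in $\{\infty,z_1,\dots,z_n\}$, and if $\zeta$ is primitive, there is no pole along $t_{\{I\}}=\infty$. Moreover $V(\boldsymbol\lambda)\subset\tilde V(\boldsymbol\lambda)$ and $$(e_{\tilde\alpha}\zeta)_{\mathcal I-\{I\}}=\sum_{\nu=1}^n\mathrm{res}_{(t_{\{I\}}=z_\nu)}\,\mathrm{res}_I\,\zeta ,\qquad e_{\tilde\alpha}:=[e_{\bar i_1},[e_{\bar i_2},\cdots[e_{\bar i_{N-1}},e_{\bar i_N}]\cdots]]\in\mathfrak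 g_{\tilde\alpha}$$ (read $e_{\bar i_1}$ if $N=1$). -/

import Mathlib

noncomputable section

open scoped Classical

namespace Polydiff

/-! ## Generalized Cartan matrices, the Lie algebra and its roots -/

/-- Generalized Cartan matrices `(c_{k,l})`. -/
structure IsGCM {r : ℕ} (A : Matrix (Fin r) (Fin r) ℤ) : Prop where
  diag : ∀ k, A k k = 2
  offDiag_nonpos : ∀ k l, k ≠ l → A k l ≤ 0
  zero_iff : ∀ k l, A k l = 0 ↔ A l k = 0

/-- The complex Lie algebra `𝔤` with generators `h_k = [e_k, f_k], e_k, f_k` and the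
Chevalley and Serre relations of the matrix `A`. -/
abbrev KM {r : ℕ} (A : Matrix (Fin r) (Fin r) ℤ) : Type := A.ToLieAlgebra ℂ

/-- The image in `𝔤` of a generator. -/
def KM.gen {r : ℕ} (A : Matrix (Fin r) (Fin r) ℤ) (x : CartanMatrix.Generators (Fin r)) : KM A :=
  LieSubmodule.Quotient.mk (N := CartanMatrix.Relations.toIdeal ℂ A) (FreeLieAlgebra.of ℂ x)

/-- Elements of the root lattice `⨁_k ℤ α_k` are given by their coefficients; this is
the simple root `α_k`. -/
def simpleRoot {r : ℕ} (k : Fin r) : Fin r → ℤ := Pi.single k 1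

/-- The grading of `𝔤` by the root lattice in which `e_k`, `f_k` and `h_k` have the degrees
`α_k`, `-α_k` and `0`: the homogeneous elements of a given degree. -/
inductive IsHomogeneous {r : ℕ} (A : Matrix (Fin r) (Fin r) ℤ) : (Fin r → ℤ) → KM A → Prop
  | e (k : Fin r) : IsHomogeneous A (simpleRoot k) (KM.gen A (.E k))
  | f (k : Fin r) : IsHomogeneous A (-simpleRoot k) (KM.gen A (.F k))
  | h (k : Fin r) : IsHomogeneous A 0 (KM.gen A (.H k))
  | zero (α : Fin r → ℤ) : IsHomogeneous A α 0
  | add {α : Fin r → ℤ} {x y : KM A} :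
      IsHomogeneous A α x → IsHomogeneous A α y → IsHomogeneous A α (x + y)
  | smul {α : Fin r → ℤ} (c : ℂ) {x : KM A} : IsHomogeneous A α x → IsHomogeneous A α (c • x)
  | lie {α β : Fin r → ℤ} {x y : KM A} :
      IsHomogeneous A α x → IsHomogeneous A β y → IsHomogeneous A (α + β) ⁅x, y⁆

/-- `α` is a root: it is nonzero and its root space in `𝔤` is nonzero. -/
def IsRoot {r : ℕ} (A : Matrix (Fin r) (Fin r) ℤ) (α : Fin r → ℤ) : Prop :=
  α ≠ 0 ∧ ∃ x : KM A, IsHomogeneous A α x ∧ x ≠ 0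

/-- `α` is a highest root: a positive root such that no `α + α_k` is a root. -/
def IsHighestRoot {r : ℕ} (A : Matrix (Fin r) (Fin r) ℤ) (α : Fin r → ℤ) : Prop :=
  IsRoot A α ∧ 0 ≤ α ∧ ∀ k, ¬ IsRoot A (α + simpleRoot k)

/-- `α_S`, the sum of the simple roots `α_s` over the terms `s` of the sequence `S`. -/
def rootSum {r : ℕ} (S : List (Fin r)) : Fin r → ℤ := (S.map simpleRoot).sum

/-- The iterated commutator `[x_S] = ad(x_{s_N}) ⋯ ad(x_{s_2}) (x_{s_1})` for
`S = (s_N, …, s_1)`, read `0` when `S` is empty. -/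
def iterBracket {R K : Type*} [Ring R] (x : K → R) : List K → R
  | [] => 0
  | [s] => x s
  | s :: s' :: S => x s * iterBracket x (s' :: S) - iterBracket x (s' :: S) * x s

/-! ## Rational functions in the `t_i` and the `z_ν`, Laurent expansions and residues -/

section Rational

variable (ι : Type*) (n : ℕ)

/-- Polynomials in the coordinates `t_i` (`i ∈ ι`) and `z_ν` (`ν = 1, …, n`). -/
abbrev Poly : Type _ := MvPolynomial (ι ⊕ Fin n) ℂ

/-- Rational functions in the coordinates `t_i` and `z_ν`. -/
def RatFn : Type _ := FractionRing (Poly ι n)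

instance : Field (RatFn ι n) := inferInstanceAs (Field (FractionRing (Poly ι n)))

instance : Algebra (Poly ι n) (RatFn ι n) :=
  inferInstanceAs (Algebra (Poly ι n) (FractionRing (Poly ι n)))

instance : IsFractionRing (Poly ι n) (RatFn ι n) :=
  inferInstanceAs (IsFractionRing (Poly ι n) (FractionRing (Poly ι n)))

instance : Algebra ℂ (RatFn ι n) :=
  ((algebraMap (Poly ι n) (RatFn ι n)).comp MvPolynomial.C).toAlgebra

variable {ι n}

/-- The coordinates, as rational functions. -/
def coord (j : ι ⊕ Fin n) : RatFn ι n := algebraMap (Poly ι n) (RatFn ι n) (MvPolynomial.X j)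

/-- The coordinate `t_i`. -/
def tc (i : ι) : RatFn ι n := coord (Sum.inl i)

/-- The coordinate `z_ν`. -/
def zc (ν : Fin n) : RatFn ι n := coord (Sum.inr ν)

/-- A Laurent series `s` in `u` that satisfies no polynomial equation with constant coefficients
and may therefore be substituted for a coordinate in rational functions. -/
def Substitutable {F : Type*} [Field F] (s : LaurentSeries F) : Prop :=
  Function.Injective (Polynomial.eval₂RingHom (HahnSeries.C : F →+* LaurentSeries F) s)

theorem substitutable_u (F : Type*) [Field F] :
    Substitutable (HahnSeries.single (1 : ℤ) (1 : F) : LaurentSeries F) := by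
  have h : ∀ p : Polynomial F,
      Polynomial.eval₂RingHom (HahnSeries.C : F →+* LaurentSeries F)
        (HahnSeries.single (1 : ℤ) (1 : F)) p = HahnSeries.ofPowerSeries ℤ F (p : PowerSeries F) := by
    intro p
    induction p using Polynomial.induction_on' with
    | add p q hp hq => rw [map_add, hp, hq]; simp
    | monomial k a =>
      rw [← Polynomial.C_mul_X_pow_eq_monomial]
      simp
  intro p q hpq
  rw [h, h] at hpq
  exact Polynomial.coe_injective F (HahnSeries.ofPowerSeries_injective hpq)

theorem substitutable_add_u {F : Type*} [Field F] (a : F) :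
    Substitutable (HahnSeries.C a + HahnSeries.single (1 : ℤ) (1 : F) : LaurentSeries F) := by
  rw [Substitutable, injective_iff_map_eq_zero]
  intro p hp
  have h2 := injective_iff_map_eq_zero _ |>.1 (substitutable_u F)
    (p.comp (Polynomial.C a + Polynomial.X)) (by
      rw [Polynomial.coe_eval₂RingHom, Polynomial.eval₂_comp]
      simpa using hp)
  have h3 := congrArg (fun q : Polynomial F => q.comp (Polynomial.X - Polynomial.C a)) h2
  simpa [Polynomial.comp_assoc] using h3

theorem substitutable_inv_u (F : Type*) [Field F] :
    Substitutable (HahnSeries.single (-1 : ℤ) (1 : F) : LaurentSeries F) := by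
  rw [Substitutable, injective_iff_map_eq_zero]
  intro p hp
  have hne : (HahnSeries.single (-1 : ℤ) (1 : F) : LaurentSeries F) ≠ 0 := by simp
  let := invertibleOfNonzero hne
  have h1 : ⅟(HahnSeries.single (-1 : ℤ) (1 : F) : LaurentSeries F)
      = HahnSeries.single (1 : ℤ) (1 : F) := by
    rw [invOf_eq_inv, HahnSeries.inv_single]; simp
  have h2 := (Polynomial.eval₂_reverse_eq_zero_iff (HahnSeries.C : F →+* LaurentSeries F)
    (HahnSeries.single (-1 : ℤ) (1 : F)) p).2 (by simpa using hp)
  rw [h1] at h2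
  have h3 := injective_iff_map_eq_zero _ |>.1 (substitutable_u F) p.reverse (by simpa using h2)
  exact (Polynomial.reverse_eq_zero).1 h3

/-- Substitution of a Laurent series `s` in a variable `u` for the coordinate `t_i`. -/
def substPoly (i : ι) (s : LaurentSeries (RatFn ι n)) : Poly ι n →+* LaurentSeries (RatFn ι n) :=
  MvPolynomial.eval₂Hom (HahnSeries.C.comp (algebraMap ℂ (RatFn ι n)))
    fun j => if j = Sum.inl i then s else HahnSeries.C (coord j)

theorem substPoly_injective (i : ι) (s : LaurentSeries (RatFn ι n)) (hs : Substitutable s) :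
    Function.Injective (substPoly i s) := by
  let ψ : Poly ι n →+* Polynomial (RatFn ι n) :=
    MvPolynomial.eval₂Hom (Polynomial.C.comp (algebraMap ℂ (RatFn ι n)))
      fun j => if j = Sum.inl i then Polynomial.X else Polynomial.C (coord j)
  have h1 : substPoly i s = (Polynomial.eval₂RingHom HahnSeries.C s).comp ψ := by
    apply MvPolynomial.ringHom_ext
    · intro c
      simp [substPoly, ψ]
    · intro j
      by_cases hj : j = Sum.inl i
      · simp [substPoly, ψ, hj]
      · simp [substPoly, ψ, hj]
  have h2 : (Polynomial.evalRingHom (tc i)).comp ψ = algebraMap (Poly ι n) (RatFn ι n) := by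
    apply MvPolynomial.ringHom_ext
    · intro c
      simp only [ψ, RingHom.comp_apply, MvPolynomial.coe_eval₂Hom, MvPolynomial.eval₂_C,
        Polynomial.coe_evalRingHom, Polynomial.eval_C]
      rfl
    · intro j
      by_cases hj : j = Sum.inl i
      · simp [ψ, hj, tc, coord]
      · simp [ψ, hj, coord]
  have h3 : Function.Injective ψ := by
    intro p q hpq
    apply IsFractionRing.injective (Poly ι n) (RatFn ι n)
    rw [← h2, RingHom.comp_apply, RingHom.comp_apply, hpq]
  rw [h1, RingHom.coe_comp]
  exact Function.Injective.comp hs h3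

/-- The expansion of rational functions that substitutes `s` for `t_i`. -/
def expand (i : ι) (s : LaurentSeries (RatFn ι n)) (hs : Substitutable s) :
    RatFn ι n →+* LaurentSeries (RatFn ι n) :=
  IsFractionRing.lift (substPoly_injective i s hs)

/-- The Laurent expansion along `t_i = a`, in the variable `u = t_i - a`. Here `a` is meant to
be a rational function that does not involve `t_i`. -/
def expandAt (i : ι) (a : RatFn ι n) : RatFn ι n →+* LaurentSeries (RatFn ι n) :=
  expand i _ (substitutable_add_u a)

/-- The Laurent expansion along `t_i = ∞`, in the variable `u = 1 / t_i`. -/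
def expandInfty (i : ι) : RatFn ι n →+* LaurentSeries (RatFn ι n) :=
  expand i _ (substitutable_inv_u (RatFn ι n))

/-- The residue of `g dt_i` along `t_i = a`. -/
def resFn (i : ι) (a g : RatFn ι n) : RatFn ι n := (expandAt i a g).coeff (-1)

/-- `g` has a pole along the hypersurface `P = 0` (`P` an irreducible polynomial): it is not in
the local ring of this hypersurface. -/
def HasPoleAlong (P : Poly ι n) (g : RatFn ι n) : Prop :=
  ¬ ∃ p q : Poly ι n, ¬ P ∣ q ∧ g * algebraMap (Poly ι n) (RatFn ι n) q = algebraMap _ _ p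

end Rational

/-! ## Polydifferentials -/

section Forms

variable (ι : Type*) (n : ℕ)

/-- Relative polydifferentials `ω = ∑_X ω^X`, possibly infinite sums over the finite subsets `X`
of `ι`, where `ω^X = ω X · ∏_{x ∈ X} dt_x` with `ω X` a rational function. -/
abbrev Form : Type _ := Finset ι → RatFn ι n

variable {ι n}

/-- The polydifferential `1`. -/
def formOne : Form ι n := fun X => if X = ∅ then 1 else 0

/-- The product of polydifferentials; the `dt_i` commute and have square zero. -/
def formMul (ω η : Form ι n) : Form ι n := fun X => ∑ Y ∈ X.powerset, ω Y * η (X \ Y)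

/-- The product of a finite sequence of polydifferentials. -/
def formProd {m : ℕ} (ω : Fin m → Form ι n) : Form ι n := (List.ofFn ω).foldr formMul formOne

/-- `ω_S = ∑_{X ⊆ S} ω^X`. -/
def formRestrict (S : Set ι) (ω : Form ι n) : Form ι n :=
  fun X => if (X : Set ι) ⊆ S then ω X else 0

/-- The residue along `t_i = a` in the `t_i`-direction: `res_{(t_i = z_ν)}` for `a = z_ν`, and
`res_{(t_i → t_j)}` for `a = t_j`. The result does not involve `t_i`. -/
def formRes (i : ι) (a : RatFn ι n) (ω : Form ι n) : Form ι n :=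
  fun X => if i ∈ X then 0 else resFn i a (ω (insert i X))

/-- `res_I = res_{(t_{i_2} → t_{i_1})} ⋯ res_{(t_{i_N} → t_{i_{N-1}})}` for
`I = (i_N, …, i_1)`; the identity when `I` is a singleton. The result is a polydifferential on the
diagonal locus `t_{i_1} = ⋯ = t_{i_N}`; the coordinate `t_{I}` on this locus is `t_{i_1}`. -/
def formResSeq : List ι → Form ι n → Form ι n
  | [], ω => ω
  | [_], ω => ω
  | i :: j :: I, ω => formResSeq (j :: I) (formRes i (tc j) ω)

/-- The poles of `ω` that involve the coordinate `t_i` occur only where `t_i` takes a value in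
`{∞, z_1, …, z_n}`: any hypersurface that involves `t_i`, other than `t_i = ∞`, along which
`ω` has a pole is one of the `t_i = z_ν`. -/
def PolesOnlyAtInftyAndZ (i : ι) (ω : Form ι n) : Prop :=
  ∀ (X : Finset ι) (P : Poly ι n), Irreducible P → Sum.inl i ∈ P.vars → HasPoleAlong P (ω X) →
    ∃ ν : Fin n, Associated P (MvPolynomial.X (Sum.inl i) - MvPolynomial.X (Sum.inr ν))

/-- `ω` has no pole along `t_i = ∞`. With `u = 1 / t_i` one has `dt_i = -u⁻² du`, so a component
that involves `dt_i` must vanish there to order at least two. -/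
def RegularAtInfty (i : ι) (ω : Form ι n) : Prop :=
  ∀ (X : Finset ι) (k : ℤ), k < (if i ∈ X then 2 else 0) → (expandInfty i (ω X)).coeff k = 0

end Forms

/-! ## The forms `ζ_I` and `ζ(S)` -/

section Zeta

variable {ι : Type*} {n : ℕ}

/-- The point which the first coordinate of the sequence `I` takes: `t_{i_N}` when
`I = (i_N, …, i_1)`, and `z_ν` when `I` is empty. -/
def headIdx (ν : Fin n) : List ι → ι ⊕ Fin n
  | [] => Sum.inr ν
  | i :: _ => Sum.inl i

/-- The coefficient of `ζ_I(z_ν)`, that is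
`1 / ((t_{i_N} - t_{i_{N-1}}) ⋯ (t_{i_2} - t_{i_1}) (t_{i_1} - z_ν))` for `I = (i_N, …, i_1)`. -/
def zetaSeq (ν : Fin n) : List ι → RatFn ι n
  | [] => 1
  | i :: I => (tc i - coord (headIdx ν I))⁻¹ * zetaSeq ν I

/-- The coefficient of `ζ_{I¹}(z_1) ⋯ ζ_{Iⁿ}(z_n)`. -/
def zetaTuple (I : Fin n → List ι) : RatFn ι n := ∏ ν, zetaSeq ν (I ν)

/-- The `n`-tuples of sequences which map to `S` and whose juxtaposition runs without repetition
through `X`. -/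
def seqTuples {r : ℕ} (π : ι → Fin r) (S : Fin n → List (Fin r)) (X : Finset ι) :
    Set (Fin n → List ι) :=
  {I | (∀ ν, (I ν).map π = S ν) ∧ ∑ ν, (I ν : Multiset ι) = X.val}

theorem finite_seqTuples {r : ℕ} (π : ι → Fin r) (S : Fin n → List (Fin r)) (X : Finset ι) :
    (seqTuples π S X).Finite := by
  have h : {l : List ι | (l : Multiset ι) ≤ X.val}.Finite := by
    refine (X.val.powerset.bind Multiset.lists).toFinset.finite_toSet.subset ?_
    intro l hl
    simp only [Finset.mem_coe, Multiset.mem_toFinset, Multiset.mem_bind, Multiset.mem_powerset]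
    exact ⟨l, hl, by simp⟩
  refine (Set.Finite.pi' (fun _ : Fin n => h)).subset ?_
  intro I hI ν
  change (I ν : Multiset ι) ≤ X.val
  rw [← hI.2]
  exact Finset.single_le_sum (f := fun ν => (I ν : Multiset ι)) (fun _ _ => zero_le) (Finset.mem_univ ν)

/-- `ζ(S)`, the sum of the `ζ_I` over all `n`-tuples `I` of sequences in `ι` whose juxtaposition
is without repetition and which map to the `n`-tuple `S`. -/
def zetaSum {r : ℕ} (π : ι → Fin r) (S : Fin n → List (Fin r)) : Form ι n :=
  fun X => ∑ I ∈ (finite_seqTuples π S X).toFinset, zetaTuple I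

/-! ### The `ζ(S)` are linearly independent -/

theorem coord_injective : Function.Injective (coord : ι ⊕ Fin n → RatFn ι n) := fun _ _ h =>
  MvPolynomial.X_injective (IsFractionRing.injective (Poly ι n) (RatFn ι n) h)

theorem expand_algebraMap (i : ι) (s : LaurentSeries (RatFn ι n)) (hs : Substitutable s)
    (p : Poly ι n) : expand i s hs (algebraMap _ _ p) = substPoly i s p :=
  IsFractionRing.lift_algebraMap _ p

theorem expandAt_coord (x : ι) (a : RatFn ι n) (j : ι ⊕ Fin n) :
    expandAt x a (coord j) = if j = Sum.inl x then
      HahnSeries.C a + HahnSeries.single (1 : ℤ) 1 else HahnSeries.C (coord j) := by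
  rw [expandAt, coord, expand_algebraMap]
  simp [substPoly, coord]

theorem expandAt_algebraMap (x : ι) (a : RatFn ι n) (c : ℂ) :
    expandAt x a (algebraMap ℂ _ c) = HahnSeries.C (algebraMap ℂ _ c) := by
  have : (algebraMap ℂ (RatFn ι n) c) = algebraMap (Poly ι n) _ (MvPolynomial.C c) := rfl
  rw [this, expandAt, expand_algebraMap]
  simp [substPoly]
  rfl

/-- The residue as a linear map. -/
def resLin (x : ι) (a : RatFn ι n) : RatFn ι n →ₗ[ℂ] RatFn ι n where
  toFun := resFn x a
  map_add' f g := by simp [resFn]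
  map_smul' c f := by
    simp only [resFn, Algebra.smul_def, map_mul, expandAt_algebraMap, RingHom.id_apply]
    rw [HahnSeries.C_mul_eq_smul, HahnSeries.coeff_smul, smul_eq_mul]

/-- `s` is a power series with constant term `v`. -/
def IsReg {F : Type*} [Field F] (s : LaurentSeries F) (v : F) : Prop :=
  ∃ p : PowerSeries F, s = HahnSeries.ofPowerSeries ℤ F p ∧ PowerSeries.constantCoeff p = v

theorem IsReg.mul {F : Type*} [Field F] {s t : LaurentSeries F} {v w : F} (hs : IsReg s v)
    (ht : IsReg t w) : IsReg (s * t) (v * w) := by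
  obtain ⟨p, rfl, rfl⟩ := hs
  obtain ⟨q, rfl, rfl⟩ := ht
  exact ⟨p * q, by simp, by simp⟩

theorem IsReg.sub {F : Type*} [Field F] {s t : LaurentSeries F} {v w : F} (hs : IsReg s v)
    (ht : IsReg t w) : IsReg (s - t) (v - w) := by
  obtain ⟨p, rfl, rfl⟩ := hs
  obtain ⟨q, rfl, rfl⟩ := ht
  exact ⟨p - q, by simp, by simp⟩

theorem IsReg.inv {F : Type*} [Field F] {s : LaurentSeries F} {v : F} (hs : IsReg s v)
    (hv : v ≠ 0) : IsReg s⁻¹ v⁻¹ := by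
  obtain ⟨p, rfl, rfl⟩ := hs
  refine ⟨p⁻¹, ?_, by simp⟩
  apply inv_eq_of_mul_eq_one_right
  rw [← map_mul, PowerSeries.mul_inv_cancel _ hv, map_one]

theorem isReg_C {F : Type*} [Field F] (v : F) : IsReg (HahnSeries.C v : LaurentSeries F) v :=
  ⟨PowerSeries.C v, by simp, by simp⟩

theorem isReg_prod {F α : Type*} [Field F] (T : Finset α) (s : α → LaurentSeries F) (v : α → F)
    (h : ∀ a ∈ T, IsReg (s a) (v a)) : IsReg (∏ a ∈ T, s a) (∏ a ∈ T, v a) := by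
  induction T using Finset.induction_on with
  | empty => simpa using isReg_C (1 : F)
  | insert a T ha ih =>
    rw [Finset.prod_insert ha, Finset.prod_insert ha]
    exact (h a (by simp)).mul (ih fun b hb => h b (by simp [hb]))

theorem IsReg.coeff {F : Type*} [Field F] {s : LaurentSeries F} {v : F} (hs : IsReg s v) :
    s.coeff (-1) = 0 := by
  obtain ⟨p, rfl, -⟩ := hs
  exact (PowerSeries.coeff_coe p (-1)).trans (if_pos (by norm_num))

theorem IsReg.coeff_single_mul {F : Type*} [Field F] {s : LaurentSeries F} {v : F}
    (hs : IsReg s v) : (HahnSeries.single (-1 : ℤ) (1 : F) * s).coeff (-1) = v := by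
  obtain ⟨p, rfl, rfl⟩ := hs
  have := HahnSeries.coeff_single_mul_add (r := (1 : F)) (x := HahnSeries.ofPowerSeries ℤ F p)
    (a := 0) (b := (-1 : ℤ))
  rw [zero_add] at this
  rw [this, one_mul]
  have := LaurentSeries.coeff_coe_powerSeries p 0
  simpa using this

/-- The substitution `t_x ↦ z_ν` on coordinates. -/
def substIdx (x : ι) (ν : Fin n) (j : ι ⊕ Fin n) : ι ⊕ Fin n :=
  if j = Sum.inl x then Sum.inr ν else j

theorem isReg_coord (x : ι) (ν : Fin n) (j : ι ⊕ Fin n) :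
    IsReg (expandAt x (zc ν) (coord j)) (coord (substIdx x ν j)) := by
  rw [expandAt_coord, substIdx]
  split_ifs
  · exact ⟨PowerSeries.C (zc ν) + PowerSeries.X, by simp, by simp [zc]⟩
  · exact isReg_C _

theorem isReg_inv_sub (x : ι) (ν : Fin n) (j k : ι ⊕ Fin n)
    (h : substIdx x ν j ≠ substIdx x ν k) :
    IsReg (expandAt x (zc ν) (coord j - coord k)⁻¹)
      (coord (substIdx x ν j) - coord (substIdx x ν k))⁻¹ := by
  rw [map_inv₀, map_sub]
  exact ((isReg_coord x ν j).sub (isReg_coord x ν k)).inv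
    (sub_ne_zero.2 fun h' => h (coord_injective h'))

theorem isReg_zetaSeq (x : ι) (ν μ : Fin n) (L : List ι) (hL : L.Nodup)
    (h : μ ≠ ν ∨ L.getLast? ≠ some x) : ∃ v, IsReg (expandAt x (zc ν) (zetaSeq μ L)) v := by
  induction L with
  | nil => exact ⟨1, by simpa [zetaSeq] using isReg_C (1 : RatFn ι n)⟩
  | cons i L ih =>
    have hL' := List.nodup_cons.1 hL
    obtain ⟨v, hv⟩ := ih hL'.2 (by
      cases L with
      | nil => right; simp
      | cons j L => simpa [List.getLast?_cons_cons] using h)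
    rw [zetaSeq, map_mul, tc]
    refine ⟨_, (isReg_inv_sub x ν _ _ ?_).mul hv⟩
    cases L with
    | nil =>
      simp only [headIdx, substIdx]
      by_cases hi : i = x
      · subst hi
        simp only [List.getLast?_singleton, ne_eq, not_true_eq_false, or_false] at h
        simp [Ne.symm h]
      · simp [hi]
    | cons j L =>
      have hij : i ≠ j := fun e => hL'.1 (by simp [e])
      simp only [headIdx, substIdx]
      by_cases hi : i = x
      · have hj : j ≠ x := fun e => hij (hi.trans e.symm)
        simp [hi, hj]
      · by_cases hj : j = x
        · simp [hi, hj]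
        · simp [hi, hj, hij]

theorem expandAt_zetaSeq_of_notMem (x : ι) (a : RatFn ι n) (μ : Fin n) (L : List ι) (hx : x ∉ L) :
    expandAt x a (zetaSeq μ L) = HahnSeries.C (zetaSeq μ L) := by
  induction L with
  | nil => simp [zetaSeq]
  | cons i L ih =>
    rw [List.mem_cons, not_or] at hx
    have h1 : headIdx μ L ≠ Sum.inl x := by
      cases L with
      | nil => simp [headIdx]
      | cons j L =>
        have : x ≠ j := fun e => hx.2 (by simp [e])
        simpa [headIdx] using this.symm
    rw [zetaSeq, map_mul, ih hx.2, tc, map_inv₀, map_sub, expandAt_coord, expandAt_coord,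
      if_neg (by simpa using Ne.symm hx.1), if_neg h1, ← map_sub, ← map_inv₀, ← map_mul]

theorem expandAt_zetaSeq_concat (x : ι) (ν : Fin n) (M : List ι) (hM : (M ++ [x]).Nodup) :
    ∃ s, expandAt x (zc ν) (zetaSeq ν (M ++ [x])) = HahnSeries.single (-1 : ℤ) 1 * s ∧
      IsReg s (zetaSeq ν M) := by
  induction M with
  | nil =>
    refine ⟨1, ?_, by simpa [zetaSeq] using isReg_C (1 : RatFn ι n)⟩
    simp only [List.nil_append, zetaSeq, headIdx, tc, mul_one, map_inv₀, map_sub, expandAt_coord]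
    simp [zc, HahnSeries.inv_single]
  | cons i M ih =>
    have hM' := List.nodup_cons.1 hM
    have hix : i ≠ x := fun e => hM'.1 (by simp [e])
    obtain ⟨s, hs, hs'⟩ := ih hM'.2
    have hM2 : substIdx x ν (headIdx ν (M ++ [x])) = headIdx ν M := by
      cases M with
      | nil => simp [headIdx, substIdx]
      | cons j M =>
        have : j ≠ x := fun e => by
          have := List.nodup_cons.1 hM'.2
          exact this.1 (by simp [e])
        simp [headIdx, substIdx, this]
    have h1 : substIdx x ν (Sum.inl i) = Sum.inl i := by simp [substIdx, hix]
    have h2 : Sum.inl i ≠ headIdx ν M := by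
      cases M with
      | nil => simp [headIdx]
      | cons j M =>
        have : i ≠ j := fun e => hM'.1 (by simp [e])
        simpa [headIdx] using this
    have h3 := isReg_inv_sub x ν (Sum.inl i) (headIdx ν (M ++ [x])) (by rw [h1, hM2]; exact h2)
    rw [h1, hM2] at h3
    refine ⟨expandAt x (zc ν) (coord (Sum.inl i) - coord (headIdx ν (M ++ [x])))⁻¹ * s, ?_, ?_⟩
    · rw [List.cons_append, zetaSeq, map_mul, hs, tc]
      ring
    · rw [zetaSeq, tc]
      exact h3.mul hs'

theorem resFn_zetaTuple_eq_zero (x : ι) (ν : Fin n) (I : Fin n → List ι)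
    (hI : ∀ μ, (I μ).Nodup) (h : (I ν).getLast? ≠ some x) :
    resFn x (zc ν) (zetaTuple I) = 0 := by
  have h1 : ∀ μ, ∃ v, IsReg (expandAt x (zc ν) (zetaSeq μ (I μ))) v := fun μ =>
    isReg_zetaSeq x ν μ (I μ) (hI μ) (by
      by_cases hμ : μ = ν
      · subst hμ; exact Or.inr h
      · exact Or.inl hμ)
  choose v hv using h1
  rw [resFn, zetaTuple, map_prod]
  exact (isReg_prod _ _ v fun μ _ => hv μ).coeff

theorem resFn_zetaTuple (x : ι) (ν : Fin n) (I : Fin n → List ι) (M : List ι)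
    (hI : I ν = M ++ [x]) (hM : (M ++ [x]).Nodup) (h : ∀ μ, μ ≠ ν → x ∉ I μ) :
    resFn x (zc ν) (zetaTuple I) = zetaTuple (Function.update I ν M) := by
  obtain ⟨s, hs, hs'⟩ := expandAt_zetaSeq_concat x ν M hM
  have h1 : ∀ μ ∈ Finset.univ.erase ν,
      expandAt x (zc ν) (zetaSeq μ (I μ)) = HahnSeries.C (zetaSeq μ (I μ)) := fun μ hμ =>
    expandAt_zetaSeq_of_notMem x _ μ (I μ) (h μ (Finset.ne_of_mem_erase hμ))
  rw [resFn, zetaTuple, map_prod, ← Finset.mul_prod_erase _ _ (Finset.mem_univ ν),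
    Finset.prod_congr rfl h1, hI, hs, mul_assoc,
    (hs'.mul (isReg_prod _ _ _ fun μ _ => isReg_C _)).coeff_single_mul, zetaTuple,
    ← Finset.mul_prod_erase _ _ (Finset.mem_univ ν), Function.update_self]
  congr 1
  refine Finset.prod_congr rfl fun μ hμ => ?_
  rw [Function.update_of_ne (Finset.ne_of_mem_erase hμ)]

theorem sum_update (I : Fin n → List ι) (ν : Fin n) (M : List ι) :
    (∑ μ, (Function.update I ν M μ : Multiset ι)) =
      M + ∑ μ ∈ Finset.univ.erase ν, (I μ : Multiset ι) := by
  rw [← Finset.add_sum_erase _ _ (Finset.mem_univ ν), Function.update_self]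
  congr 1
  refine Finset.sum_congr rfl fun μ hμ => ?_
  rw [Function.update_of_ne (Finset.ne_of_mem_erase hμ)]

theorem exists_separating (N : ℕ) : ∀ I₀ : Fin n → List ι,
    (∑ ν, (I₀ ν : Multiset ι)).card = N → (∑ ν, (I₀ ν : Multiset ι)).Nodup →
    ∃ R : RatFn ι n →ₗ[ℂ] RatFn ι n, R (zetaTuple I₀) = 1 ∧ ∀ I : Fin n → List ι, I ≠ I₀ →
      (∑ ν, (I ν : Multiset ι)) = ∑ ν, (I₀ ν : Multiset ι) → R (zetaTuple I) = 0 := by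
  induction N with
  | zero =>
    intro I₀ h0 _
    have hz : ∀ I : Fin n → List ι, (∑ ν, (I ν : Multiset ι)) = 0 → I = fun _ => [] := by
      intro I hI
      funext ν
      simpa using (Finset.sum_eq_zero_iff.1 hI) ν (Finset.mem_univ ν)
    have h1 := Multiset.card_eq_zero.1 h0
    refine ⟨LinearMap.id, ?_, fun I hI h => ?_⟩
    · simp [hz I₀ h1, zetaTuple, zetaSeq]
    · exact absurd ((hz I (h.trans h1)).trans (hz I₀ h1).symm) hI
  | succ N ih =>
    intro I₀ h0 hnd
    obtain ⟨ν, hν⟩ : ∃ ν, I₀ ν ≠ [] := by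
      by_contra hc
      push Not at hc
      simp [hc] at h0
    obtain ⟨M, x, hMx⟩ := (List.eq_nil_or_concat (I₀ ν)).resolve_left hν
    have key : ∀ (I : Fin n → List ι) (M : List ι), I ν = M ++ [x] →
        (∑ μ, (I μ : Multiset ι)) = x ::ₘ ∑ μ, (Function.update I ν M μ : Multiset ι) := by
      intro I M hI
      rw [sum_update, ← Finset.add_sum_erase _ _ (Finset.mem_univ ν), hI, ← Multiset.coe_add,
        ← Multiset.singleton_add]
      rw [show (([x] : List ι) : Multiset ι) = {x} from rfl]
      abel
    have good : ∀ I : Fin n → List ι, (∑ μ, (I μ : Multiset ι)).Nodup →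
        (∀ μ, (I μ).Nodup) ∧ ∀ M, I ν = M ++ [x] → ∀ μ, μ ≠ ν → x ∉ I μ := by
      intro I hI
      refine ⟨fun μ => ?_, fun M hM μ hμ hx => ?_⟩
      · have := Multiset.nodup_of_le (Finset.single_le_sum (f := fun ν => (I ν : Multiset ι))
          (fun _ _ => zero_le) (Finset.mem_univ μ)) hI
        simpa using this
      · rw [key I M hM] at hI
        refine (Multiset.nodup_cons.1 hI).1 ?_
        rw [Multiset.mem_sum]
        exact ⟨μ, Finset.mem_univ μ, by rw [Function.update_of_ne hμ]; simpa using hx⟩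
    have hk := key I₀ M (by simpa using hMx)
    obtain ⟨R, hR1, hR2⟩ := ih (Function.update I₀ ν M)
      (by rw [hk] at h0; simpa using h0) (by rw [hk] at hnd; exact (Multiset.nodup_cons.1 hnd).2)
    have hM' : I₀ ν = M ++ [x] := by simpa using hMx
    refine ⟨R ∘ₗ resLin x (zc ν), ?_, fun I hI h => ?_⟩
    · have := (good I₀ hnd).1 ν
      rw [hM'] at this
      change R (resFn x (zc ν) (zetaTuple I₀)) = 1
      rw [resFn_zetaTuple x ν I₀ M hM' this ((good I₀ hnd).2 M hM'), hR1]
    · change R (resFn x (zc ν) (zetaTuple I)) = 0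
      have hnd' : (∑ μ, (I μ : Multiset ι)).Nodup := by rw [h]; exact hnd
      by_cases hl : (I ν).getLast? = some x
      · obtain ⟨M₂, hM₂⟩ := List.getLast?_eq_some_iff.1 hl
        have := (good I hnd').1 ν
        rw [hM₂] at this
        rw [resFn_zetaTuple x ν I M₂ hM₂ this ((good I hnd').2 M₂ hM₂)]
        refine hR2 _ (fun he => hI ?_) ?_
        · funext μ
          by_cases hμ : μ = ν
          · subst hμ
            have := congrFun he μ
            rw [Function.update_self, Function.update_self] at this
            rw [hM₂, hM', this]
          · have := congrFun he μ
            rwa [Function.update_of_ne hμ, Function.update_of_ne hμ] at this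
        · rw [key I M₂ hM₂, hk] at h
          exact (Multiset.cons_inj_right x).1 h
      · rw [resFn_zetaTuple_eq_zero x ν I (good I hnd').1 hl, map_zero]

theorem exists_list {r : ℕ} (π : ι → Fin r) (hπ : ∀ k, (π ⁻¹' {k}).Infinite) (X : Finset ι)
    (S : List (Fin r)) : ∃ L : List ι, L.map π = S ∧ L.Nodup ∧ ∀ i ∈ L, i ∉ X := by
  induction S with
  | nil => exact ⟨[], by simp⟩
  | cons k S ih =>
    obtain ⟨L, h1, h2, h3⟩ := ih
    obtain ⟨i, hi, hi'⟩ := (hπ k).exists_notMem_finset (X ∪ L.toFinset)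
    simp only [Finset.mem_union, List.mem_toFinset, not_or] at hi'
    refine ⟨i :: L, by simpa [h1] using hi, List.nodup_cons.2 ⟨hi'.2, h2⟩, ?_⟩
    intro j hj
    rcases List.mem_cons.1 hj with rfl | hj
    · exact hi'.1
    · exact h3 j hj

theorem exists_tuple {r : ℕ} (π : ι → Fin r) (hπ : ∀ k, (π ⁻¹' {k}).Infinite)
    (S : Fin n → List (Fin r)) (T : Finset (Fin n)) :
    ∃ I : Fin n → List ι, (∀ ν ∈ T, (I ν).map π = S ν) ∧ (∑ ν ∈ T, (I ν : Multiset ι)).Nodup := by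
  induction T using Finset.induction_on with
  | empty => exact ⟨fun _ => [], by simp⟩
  | insert ν T hν ih =>
    obtain ⟨I, h1, h2⟩ := ih
    obtain ⟨L, h3, h4, h5⟩ := exists_list π hπ (∑ ν ∈ T, (I ν : Multiset ι)).toFinset (S ν)
    have hu : ∀ μ ∈ T, Function.update I ν L μ = I μ := fun μ hμ =>
      Function.update_of_ne (fun e => hν (by rw [← e]; exact hμ)) _ _
    refine ⟨Function.update I ν L, fun μ hμ => ?_, ?_⟩
    · rcases Finset.mem_insert.1 hμ with rfl | hμ
      · simpa using h3
      · rw [hu μ hμ]; exact h1 μ hμ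
    · rw [Finset.sum_insert hν, Function.update_self,
        Finset.sum_congr rfl fun μ hμ => by rw [hu μ hμ], Multiset.nodup_add]
      refine ⟨by simpa using h4, h2, ?_⟩
      rw [Multiset.disjoint_left]
      intro i hi hi'
      exact h5 i (by simpa using hi) (by simpa using hi')

theorem zetaSum_linearIndependent {r : ℕ} (π : ι → Fin r) (hπ : ∀ k, (π ⁻¹' {k}).Infinite) :
    LinearIndependent ℂ (zetaSum π : (Fin n → List (Fin r)) → Form ι n) := by
  rw [linearIndependent_iff']
  intro T g hg S₀ hS₀
  obtain ⟨I₀, h1, h2⟩ := exists_tuple π hπ S₀ Finset.univ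
  obtain ⟨R, hR1, hR2⟩ := exists_separating _ I₀ rfl h2
  let X : Finset ι := ⟨∑ ν, (I₀ ν : Multiset ι), h2⟩
  have h3 := congrArg R (congrFun hg X)
  have h4 : ∀ S, R (zetaSum π S X) = if S = S₀ then 1 else 0 := by
    intro S
    rw [zetaSum, map_sum]
    split_ifs with hS
    · subst hS
      rw [Finset.sum_eq_single I₀, hR1]
      · intro I hI hne
        exact hR2 I hne (((finite_seqTuples π S X).mem_toFinset).1 hI).2
      · intro hI
        exact absurd (((finite_seqTuples π S X).mem_toFinset).2 ⟨fun ν => h1 ν (by simp), rfl⟩) hI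
    · refine Finset.sum_eq_zero fun I hI => ?_
      have hI' := ((finite_seqTuples π S X).mem_toFinset).1 hI
      refine hR2 I (fun e => hS ?_) hI'.2
      funext ν
      rw [← hI'.1 ν, e, h1 ν (by simp)]
  rw [Finset.sum_apply, map_sum] at h3
  simp only [Pi.smul_apply, map_smul, h4, Pi.zero_apply, map_zero, smul_ite, smul_zero] at h3
  rw [Finset.sum_ite_eq' T S₀, if_pos hS₀] at h3
  simpa using h3

end Zeta

/-! ## The representations -/

section Rep

variable {ι : Type*} {n r : ℕ}

/-- `Φ_i = p_i dt_i / (t_i - z_ν) - ∑_{j ≠ i} c_{i,j} dt_i dt_j / (t_i - t_j) ι_{∂/∂t_j}`, acting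
on the `ν`-th factor; here `c_{i,j} = c_{π(i),π(j)}` and `p_i = λ(α̌_{π(i)})`, where the weight
`λ` is given by the numbers `lam k = λ(α̌_k)`. -/
def phiOp (A : Matrix (Fin r) (Fin r) ℤ) (π : ι → Fin r) (lam : Fin r → ℝ) (ν : Fin n) (i : ι)
    (ω : Form ι n) : Form ι n :=
  fun X => if i ∈ X then
    (algebraMap ℂ (RatFn ι n) (lam (π i)) / (tc i - zc ν)
      - ∑ j ∈ X.erase i, (A (π i) (π j) : RatFn ι n) / (tc i - tc j)) * ω (X.erase i)
  else 0

/-- `f_k = ∑_{π(i) = k} Φ_i`, acting on the `ν`-th factor. -/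
def fOp (A : Matrix (Fin r) (Fin r) ℤ) (π : ι → Fin r) (lam : Fin r → ℝ) (ν : Fin n) (k : Fin r)
    (ω : Form ι n) : Form ι n :=
  fun X => ∑ i ∈ X with π i = k, phiOp A π lam ν i ω X

/-- `V(λ)`, as a space of polydifferentials with base coordinate `z_ν`: the smallest linear
subspace that contains `1` and is stable under the operators `f_k`. -/
def factorV (A : Matrix (Fin r) (Fin r) ℤ) (π : ι → Fin r) (lam : Fin r → ℝ) (ν : Fin n) :
    Submodule ℂ (Form ι n) :=
  sInf {W | formOne ∈ W ∧ ∀ k, ∀ ω ∈ W, fOp A π lam ν k ω ∈ W}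

/-- `V(λ_1, …, λ_n) = V(λ_1) ⊗ ⋯ ⊗ V(λ_n)`, as a space of polydifferentials: it is spanned by the
products `ω_1(z_1) ⋯ ω_n(z_n)` with `ω_ν ∈ V(λ_ν)`. -/
def tensorV (A : Matrix (Fin r) (Fin r) ℤ) (π : ι → Fin r) (lam : Fin n → Fin r → ℝ) :
    Submodule ℂ (Form ι n) :=
  Submodule.span ℂ {η | ∃ ω : Fin n → Form ι n, (∀ ν, ω ν ∈ factorV A π (lam ν) ν) ∧
    η = formProd ω}

/-- The space of invariant polydifferentials with basis the `ζ(S)`, `S` an `n`-tuple of sequences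
in `{1, …, r}`; this is the space underlying `Ṽ(λ_1, …, λ_n)`. -/
def tildeV (ι : Type*) (n : ℕ) {r : ℕ} (π : ι → Fin r) : Submodule ℂ (Form ι n) :=
  Submodule.span ℂ (Set.range (zetaSum π : (Fin n → List (Fin r)) → Form ι n))

/-- The basis of the `ζ(S)`. -/
def zetaBasis (n : ℕ) {π : ι → Fin r} (hπ : ∀ k, (π ⁻¹' {k}).Infinite) :
    Module.Basis (Fin n → List (Fin r)) ℂ (tildeV ι n π) :=
  Module.Basis.span (zetaSum_linearIndependent π hπ)

theorem coe_zetaBasis {π : ι → Fin r} (hπ : ∀ k, (π ⁻¹' {k}).Infinite)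
    (S : Fin n → List (Fin r)) : (zetaBasis n hπ S : Form ι n) = zetaSum π S := by
  exact congrArg Subtype.val (Module.Basis.span_apply (zetaSum_linearIndependent π hπ) S)

/-- The operator `e_k` in `Ṽ(λ_1, …, λ_n)`. It is the sum over `ν` of the operators `e_k` in the
`ν`-th factor: these take `ζ(S)` to `ζ(S')` if `S^ν = k S'^ν` and `S^μ = S'^μ` for `μ ≠ ν`, and
to zero if the sequence `S^ν` does not begin with `k`. -/
def eOp (n : ℕ) {π : ι → Fin r} (hπ : ∀ k, (π ⁻¹' {k}).Infinite) (k : Fin r) :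
    Module.End ℂ (tildeV ι n π) :=
  (zetaBasis n hπ).constr ℂ fun S => ∑ ν : Fin n,
    if (S ν).head? = some k then zetaBasis n hπ (Function.update S ν (S ν).tail) else 0

theorem eOp_zetaBasis {π : ι → Fin r} (hπ : ∀ k, (π ⁻¹' {k}).Infinite) (k : Fin r)
    (S : Fin n → List (Fin r)) : eOp n hπ k (zetaBasis n hπ S) = ∑ ν : Fin n,
      if (S ν).head? = some k then zetaBasis n hπ (Function.update S ν (S ν).tail) else 0 :=
  Module.Basis.constr_basis _ _ _ _

/-- The action on `Ṽ(λ_1, …, λ_n)` of the iterated bracket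
`e_S = [e_{s_1}, [e_{s_2}, ⋯ [e_{s_{N-1}}, e_{s_N}] ⋯ ]]`, where `S = (s_N, …, s_1)`. -/
def eBracket (n : ℕ) {π : ι → Fin r} (hπ : ∀ k, (π ⁻¹' {k}).Infinite) (S : List (Fin r)) :
    Module.End ℂ (tildeV ι n π) :=
  iterBracket (eOp n hπ) S.reverse

/-- `ω` is a primitive element of `Ṽ(λ_1, …, λ_n)`: it is killed by all `e_k`. -/
def IsPrimitive {π : ι → Fin r} (hπ : ∀ k, (π ⁻¹' {k}).Infinite) (ω : Form ι n) : Prop :=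
  ∃ hω : ω ∈ tildeV ι n π, ∀ k, eOp n hπ k ⟨ω, hω⟩ = 0

end Rep

end Polydiff

end

open scoped Classical

noncomputable section

namespace Polydiff

/-! A polydifferential in V(λ) is encoded by its coefficients on the ζ_L, that is, by a function w
of words in {1, …, r}. In this encoding e_k becomes (e_k w)(S) = w(kS). By partial fractions, f_k
becomes a sum over the occurrences of the letter k: strike one out, and multiply by the value on
α̌_k of λ minus the simple roots of the letters to its right. The functions generated from the
vacuum by the f_k form a module (`hwMod`) in which the Chevalley relations hold. The Serre relations
hold there too. A Serre element in the e's commutes with all f_s and kills the vacuum. One in the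
f's commutes with all e_s and produces functions that vanish on the empty word. Hence 𝔤 acts, and an
iterated bracket of e's whose weight is not a root acts by zero (`iterBracket_hwE_eq_zero`).

Residues are brackets. Replace the e's by an arbitrary operator X_i for each index i, and let the
coefficient on a sequence be the value at the empty word after the X_i have acted in turn
(`opForm`). The sum over all insertions of t_x in a sequence has, by partial fractions, simple poles
at the t_l, whose residue is the difference between inserting x just before and just after l, and
one at z_ν (`sum_insert_zetaSeq`). So the residue along t_x = t_y is again such a form, with X_y
replaced by [X_y, X_x] (`resFn_opForm`). By iteration res_I puts the bracket [e_{i_1}, [… ,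
e_{i_N}]] at the index i_1.

If the weight of this bracket is not a root, the residue vanishes. As res_I factors through res_J
for each initial part J, this is the first assertion. If the weight is the highest root, the bracket
commutes with every e_k in the module, so all differences at the t_l vanish and only the poles at
the z_ν remain: the components of res_I ζ containing dt_{i_1} are ∑_ν (t_{i_1} - z_ν)⁻¹ dt_{i_1}
times the action of the bracket in the ν-th factor (`formResSeq_pureFn`). The location of the poles,
the residues at the z_ν, and the coefficient e_α̃ ζ of 1/t_{i_1} at infinity can be read off from
this formula. -/

/-! ### Serre elements in a Lie algebra with the Chevalley relations -/

/-- The Chevalley relations of `A`, without the Serre relations. -/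
structure IsChevalley {r : ℕ} (A : Matrix (Fin r) (Fin r) ℤ) {L : Type*} [LieRing L]
    (H E F : Fin r → L) : Prop where
  lie_h_h : ∀ k l, ⁅H k, H l⁆ = 0
  lie_e_f : ∀ k l, ⁅E k, F l⁆ = if k = l then H k else 0
  lie_h_e : ∀ k l, ⁅H k, E l⁆ = A k l • E l
  lie_h_f : ∀ k l, ⁅H k, F l⁆ = -(A k l • F l)

namespace IsChevalley

theorem symm {r : ℕ} {A : Matrix (Fin r) (Fin r) ℤ} {L : Type*} [LieRing L] {H E F : Fin r → L}
    (h : IsChevalley A H E F) : IsChevalley A (fun k => -H k) F E where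
  lie_h_h k l := by simp [h.lie_h_h]
  lie_e_f k l := by
    rw [← lie_skew, h.lie_e_f]
    by_cases hkl : k = l
    · simp [hkl]
    · simp [hkl, Ne.symm hkl]
  lie_h_e k l := by simp [h.lie_h_f]
  lie_h_f k l := by simp [h.lie_h_e]

variable {r : ℕ} {A : Matrix (Fin r) (Fin r) ℤ} {L : Type*} [LieRing L] [LieAlgebra ℂ L]
  {H E F : Fin r → L}

theorem lie_h_ad_pow (h : IsChevalley A H E F) (hA : IsGCM A) (k l : Fin r) (m : ℕ) :
    ⁅H k, (LieAlgebra.ad ℂ L (F k) ^ m) (F l)⁆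
      = -((A k l + 2 * m) • (LieAlgebra.ad ℂ L (F k) ^ m) (F l)) := by
  induction m with
  | zero => simp [h.lie_h_f]
  | succ m ih =>
    rw [pow_succ', Module.End.mul_apply, LieAlgebra.ad_apply, leibniz_lie, ih, h.lie_h_f, hA.diag]
    simp only [neg_lie, lie_neg, zsmul_lie, lie_zsmul]
    push_cast
    module

/-- The sl₂ computation: each `F k` passed by `E k` contributes an eigenvalue -(A k l + 2j) of `H
k`, and these add up over j = 0, …, m to -(m + 1)(A k l + m). -/
theorem lie_e_ad_pow_succ (h : IsChevalley A H E F) (hA : IsGCM A) {k l : Fin r} (hkl : k ≠ l)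
    (m : ℕ) : ⁅E k, (LieAlgebra.ad ℂ L (F k) ^ (m + 1)) (F l)⁆
      = -(((m + 1) * (A k l + m)) • (LieAlgebra.ad ℂ L (F k) ^ m) (F l)) := by
  induction m with
  | zero =>
    simp [leibniz_lie (E k), h.lie_e_f, hkl, h.lie_h_f]
  | succ m ih =>
    rw [pow_succ', Module.End.mul_apply, LieAlgebra.ad_apply, leibniz_lie, ih, h.lie_e_f,
      if_pos rfl, h.lie_h_ad_pow hA, lie_neg, lie_zsmul, ← LieAlgebra.ad_apply ℂ L (F k),
      ← Module.End.mul_apply, ← pow_succ']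
    push_cast
    module

theorem lie_e_ad_pow_of_ne (h : IsChevalley A H E F) {k l s : Fin r} (hk : s ≠ k) (hl : s ≠ l)
    (m : ℕ) : ⁅E s, (LieAlgebra.ad ℂ L (F k) ^ m) (F l)⁆ = 0 := by
  induction m with
  | zero => simp [h.lie_e_f, hl]
  | succ m ih =>
    rw [pow_succ', Module.End.mul_apply, LieAlgebra.ad_apply, leibniz_lie, ih, h.lie_e_f,
      if_neg hk]
    simp

/-- `E l` turns `F l` into `H l`; one `ad (F k)` makes this a multiple of `F k`, and the next one
kills it. Two factors are therefore needed, and a single one has to be treated apart. -/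
theorem lie_e_ad_pow_add_two (h : IsChevalley A H E F) {k l : Fin r} (hkl : k ≠ l) (m : ℕ) :
    ⁅E l, (LieAlgebra.ad ℂ L (F k) ^ (m + 2)) (F l)⁆ = 0 := by
  induction m with
  | zero =>
    rw [zero_add, pow_two, Module.End.mul_apply, LieAlgebra.ad_apply, LieAlgebra.ad_apply,
      leibniz_lie, h.lie_e_f, if_neg hkl.symm, leibniz_lie (E l), h.lie_e_f, if_neg hkl.symm,
      h.lie_e_f, if_pos rfl, ← lie_skew (F k) (H l), h.lie_h_f]
    simp
  | succ m ih =>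
    rw [show m + 1 + 2 = (m + 2) + 1 from rfl, pow_succ', Module.End.mul_apply,
      LieAlgebra.ad_apply, leibniz_lie, ih, h.lie_e_f, if_neg hkl.symm]
    simp

/-- The Serre elements in the `F k` commute with all `E s`. -/
theorem lie_e_serre (h : IsChevalley A H E F) (hA : IsGCM A) {k l : Fin r} (hkl : k ≠ l)
    (s : Fin r) :
    ⁅E s, (LieAlgebra.ad ℂ L (F k) ^ (-A k l).toNat) ⁅F k, F l⁆⁆ = 0 := by
  have h1 := hA.offDiag_nonpos k l hkl
  rw [← LieAlgebra.ad_apply ℂ L (F k), ← Module.End.mul_apply, ← pow_succ]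
  by_cases hk : s = k
  · subst hk
    rw [h.lie_e_ad_pow_succ hA hkl]
    -- The Serre exponent is exactly the one at which the second factor of the sl₂ coefficient
    -- vanishes; nonpositivity of `A s l` makes `toNat` lossless.
    have : A s l + ((-A s l).toNat : ℤ) = 0 := by omega
    rw [this]
    simp
  by_cases hl : s = l
  · subst hl
    obtain ⟨m, hm⟩ : ∃ m, (-A k s).toNat = m := ⟨_, rfl⟩
    rw [hm]
    cases m with
    | zero =>
      -- With a single `ad (F k)` the bracket is a multiple of `A s k`, so it vanishes because zero
      -- entries of a generalized Cartan matrix occur symmetrically.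
      have h0 : A k s = 0 := by omega
      have h0' : A s k = 0 := (hA.zero_iff k s).1 h0
      rw [zero_add, pow_one, LieAlgebra.ad_apply, leibniz_lie, h.lie_e_f, if_neg hkl.symm,
        h.lie_e_f, if_pos rfl, ← lie_skew (F k) (H s), h.lie_h_f, h0']
      simp
    | succ m => exact h.lie_e_ad_pow_add_two hkl m
  · exact h.lie_e_ad_pow_of_ne hk hl _

end IsChevalley

/-! ### The operators on functions of words -/

section Words

variable {r : ℕ}

/-- `e_k` on functions of words. -/
def delOp {K : Type*} (k : K) : Module.End ℂ (List K → ℂ) := LinearMap.funLeft ℂ ℂ (List.cons k)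

theorem delOp_apply {K : Type*} (k : K) (w : List K → ℂ) (S : List K) :
    delOp k w S = w (k :: S) := rfl

/-- The value of `λ - α_S` on the coroot `α̌_k`. -/
def weightVal (A : Matrix (Fin r) (Fin r) ℤ) (lam : Fin r → ℂ) (k : Fin r) (S : List (Fin r)) : ℂ :=
  lam k - (S.map fun s => (A k s : ℂ)).sum

/-- `α̌_k` on functions of words. -/
def cartanOp (A : Matrix (Fin r) (Fin r) ℤ) (lam : Fin r → ℂ) (k : Fin r) :
    Module.End ℂ (List (Fin r) → ℂ) where
  toFun w S := weightVal A lam k S * w S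
  map_add' v w := by ext S; simp [mul_add]
  map_smul' c w := by ext S; simp [mul_left_comm]

/-- The values of `f_k w`. -/
def insVal (A : Matrix (Fin r) (Fin r) ℤ) (lam : Fin r → ℂ) (k : Fin r) :
    List (Fin r) → (List (Fin r) → ℂ) →ₗ[ℂ] ℂ
  | [] => 0
  | s :: S => insVal A lam k S ∘ₗ delOp s +
      if s = k then LinearMap.proj S ∘ₗ cartanOp A lam k else 0

/-- `f_k` on functions of words. -/
def insOp (A : Matrix (Fin r) (Fin r) ℤ) (lam : Fin r → ℂ) (k : Fin r) :
    Module.End ℂ (List (Fin r) → ℂ) :=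
  LinearMap.pi (insVal A lam k)

variable (A : Matrix (Fin r) (Fin r) ℤ) (lam : Fin r → ℂ)

theorem cartanOp_apply (k : Fin r) (w : List (Fin r) → ℂ) (S : List (Fin r)) :
    cartanOp A lam k w S = weightVal A lam k S * w S := rfl

@[simp]
theorem insOp_nil (k : Fin r) (w : List (Fin r) → ℂ) : insOp A lam k w [] = 0 := rfl

theorem insOp_cons (k s : Fin r) (w : List (Fin r) → ℂ) (S : List (Fin r)) :
    insOp A lam k w (s :: S) = insOp A lam k (delOp s w) S +
      if s = k then weightVal A lam k S * w S else 0 := by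
  simp only [insOp, LinearMap.pi_apply, insVal]
  split_ifs <;> simp [cartanOp_apply]

theorem weightVal_cons (k s : Fin r) (S : List (Fin r)) :
    weightVal A lam k (s :: S) = weightVal A lam k S - A k s := by
  simp [weightVal]; ring

/-- The recursion defining `insVal` on the first letter is the relation [e_s, f_k] = δ_{sk} α̌_k,
evaluated at a word. -/
theorem delOp_insOp (k s : Fin r) (w : List (Fin r) → ℂ) :
    delOp s (insOp A lam k w) = insOp A lam k (delOp s w) + if s = k then cartanOp A lam k w else 0
    := by
  ext S
  rw [delOp_apply, insOp_cons]
  split_ifs <;> simp [cartanOp_apply]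

theorem delOp_cartanOp (k s : Fin r) (w : List (Fin r) → ℂ) :
    delOp s (cartanOp A lam k w) = cartanOp A lam k (delOp s w) - (A k s : ℂ) • delOp s w := by
  ext S
  simp only [delOp_apply, cartanOp_apply, weightVal_cons, Pi.sub_apply, Pi.smul_apply, smul_eq_mul]
  ring

theorem cartanOp_insOp (k l : Fin r) (w : List (Fin r) → ℂ) :
    cartanOp A lam k (insOp A lam l w)
      = insOp A lam l (cartanOp A lam k w) - (A k l : ℂ) • insOp A lam l w := by
  ext S
  induction S generalizing w with
  | nil => simp [cartanOp_apply]
  | cons s S ih =>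
    have h1 := ih (delOp s w)
    simp only [cartanOp_apply, insOp_cons, Pi.sub_apply, Pi.smul_apply, smul_eq_mul,
      delOp_cartanOp, map_sub, map_smul, weightVal_cons] at h1 ⊢
    split_ifs with h
    · subst h; linear_combination h1
    · linear_combination h1

/-! ### The module generated by the vacuum and its Chevalley relations -/

/-- The indicator function of the empty word. -/
def vacuum (K : Type*) : List K → ℂ := fun S => if S = [] then 1 else 0

theorem delOp_vacuum {K : Type*} (k : K) : delOp k (vacuum K) = 0 := by
  ext S; simp [delOp_apply, vacuum]

theorem cartanOp_vacuum (k : Fin r) : cartanOp A lam k (vacuum _) = lam k • vacuum _ := by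
  ext S
  by_cases h : S = [] <;> simp [cartanOp_apply, vacuum, h, weightVal]

/-- The highest weight module of highest weight `λ`, as a space of functions of words. -/
def hwMod : Submodule ℂ (List (Fin r) → ℂ) :=
  sInf {W | vacuum _ ∈ W ∧ ∀ k, ∀ w ∈ W, insOp A lam k w ∈ W}

theorem vacuum_mem : vacuum _ ∈ hwMod A lam := by
  simp only [hwMod, Submodule.mem_sInf]
  exact fun W hW => hW.1

theorem insOp_mem (k : Fin r) {w : List (Fin r) → ℂ} (hw : w ∈ hwMod A lam) :
    insOp A lam k w ∈ hwMod A lam := by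
  simp only [hwMod, Submodule.mem_sInf] at hw ⊢
  exact fun W hW => hW.2 k w (hw W hW)

/-- Induction over the module: stability under the f_k need only be checked on those elements of `W`
that already lie in the module. -/
theorem hwMod_le {W : Submodule ℂ (List (Fin r) → ℂ)} (h0 : vacuum _ ∈ W)
    (h1 : ∀ k, ∀ w ∈ hwMod A lam, w ∈ W → insOp A lam k w ∈ W) : hwMod A lam ≤ W := by
  have : hwMod A lam ≤ hwMod A lam ⊓ W := by
    refine sInf_le ⟨⟨vacuum_mem A lam, h0⟩, fun k w hw => ⟨insOp_mem A lam k hw.1, ?_⟩⟩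
    exact h1 k w hw.1 hw.2
  exact this.trans inf_le_right

theorem cartanOp_mem (k : Fin r) : ∀ {w : List (Fin r) → ℂ}, w ∈ hwMod A lam →
    cartanOp A lam k w ∈ hwMod A lam := by
  have : hwMod A lam ≤ (hwMod A lam).comap (cartanOp A lam k) := by
    refine hwMod_le A lam ?_ fun l w hw h => ?_
    · rw [Submodule.mem_comap, cartanOp_vacuum]
      exact Submodule.smul_mem _ _ (vacuum_mem A lam)
    · rw [Submodule.mem_comap, cartanOp_insOp]
      exact Submodule.sub_mem _ (insOp_mem A lam l h)
        (Submodule.smul_mem _ _ (insOp_mem A lam l hw))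
  exact fun {w} hw => this hw

theorem delOp_mem (k : Fin r) : ∀ {w : List (Fin r) → ℂ}, w ∈ hwMod A lam →
    delOp k w ∈ hwMod A lam := by
  have : hwMod A lam ≤ (hwMod A lam).comap (delOp k) := by
    refine hwMod_le A lam ?_ fun l w hw h => ?_
    · rw [Submodule.mem_comap, delOp_vacuum]
      exact Submodule.zero_mem _
    · rw [Submodule.mem_comap, delOp_insOp]
      refine Submodule.add_mem _ (insOp_mem A lam l h) ?_
      split_ifs
      · exact cartanOp_mem A lam l hw
      · exact Submodule.zero_mem _
  exact fun {w} hw => this hw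

/-- `e_k` in the highest weight module. -/
def hwE (k : Fin r) : Module.End ℂ (hwMod A lam) :=
  (delOp k).restrict fun _ => delOp_mem A lam k

/-- `f_k` in the highest weight module. -/
def hwF (k : Fin r) : Module.End ℂ (hwMod A lam) :=
  (insOp A lam k).restrict fun _ => insOp_mem A lam k

/-- `α̌_k` in the highest weight module. -/
def hwH (k : Fin r) : Module.End ℂ (hwMod A lam) :=
  (cartanOp A lam k).restrict fun _ => cartanOp_mem A lam k

theorem coe_hwE (k : Fin r) (w : hwMod A lam) : (hwE A lam k w : List (Fin r) → ℂ) = delOp k w :=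
  rfl

theorem coe_hwF (k : Fin r) (w : hwMod A lam) :
    (hwF A lam k w : List (Fin r) → ℂ) = insOp A lam k w := rfl

theorem coe_hwH (k : Fin r) (w : hwMod A lam) :
    (hwH A lam k w : List (Fin r) → ℂ) = cartanOp A lam k w := rfl

attribute [local instance] LieRing.ofAssociativeRing

theorem isChevalley_hw : IsChevalley A (hwH A lam) (hwE A lam) (hwF A lam) where
  lie_h_h k l := by
    refine LinearMap.ext fun w => Subtype.ext (funext fun S => ?_)
    simp only [Ring.lie_def, LinearMap.sub_apply, Module.End.mul_apply, Submodule.coe_sub, coe_hwH,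
      Pi.sub_apply, cartanOp_apply, LinearMap.zero_apply, Submodule.coe_zero, Pi.zero_apply]
    ring
  lie_e_f k l := by
    refine LinearMap.ext fun w => Subtype.ext ?_
    simp only [Ring.lie_def, LinearMap.sub_apply, Module.End.mul_apply, Submodule.coe_sub, coe_hwE,
      coe_hwF, delOp_insOp]
    split_ifs with h
    · subst h; simp [coe_hwH]
    · simp
  lie_h_e k l := by
    refine LinearMap.ext fun w => Subtype.ext ?_
    simp only [Ring.lie_def, LinearMap.sub_apply, Module.End.mul_apply, Submodule.coe_sub, coe_hwE,
      coe_hwH, delOp_cartanOp, LinearMap.smul_apply, Int.cast_smul_eq_zsmul]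
    abel
  lie_h_f k l := by
    refine LinearMap.ext fun w => Subtype.ext ?_
    simp only [Ring.lie_def, LinearMap.sub_apply, Module.End.mul_apply, Submodule.coe_sub, coe_hwF,
      coe_hwH, cartanOp_insOp, LinearMap.smul_apply, Int.cast_smul_eq_zsmul,
      LinearMap.neg_apply, Submodule.coe_neg]
    abel


/-! ### The Serre relations in the module -/

/-- With the roles of the e's and f's exchanged, `lie_e_serre` makes the Serre element θ commute
with all f_s. Every term of θ has an e acting first, so θ kills the vacuum, and thus everything
generated from it. -/
theorem hw_serre_e (hA : IsGCM A) {k l : Fin r} (hkl : k ≠ l) :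
    (LieAlgebra.ad ℂ _ (hwE A lam k) ^ (-A k l).toNat) ⁅hwE A lam k, hwE A lam l⁆ = 0 := by
  have hcomm := (isChevalley_hw A lam).symm.lie_e_serre hA hkl
  set θ := (LieAlgebra.ad ℂ _ (hwE A lam k) ^ (-A k l).toNat) ⁅hwE A lam k, hwE A lam l⁆ with hθ
  have hE : ∀ s, hwE A lam s ⟨vacuum _, vacuum_mem A lam⟩ = 0 := fun s =>
    Subtype.ext (delOp_vacuum s)
  have hvac : θ ⟨vacuum _, vacuum_mem A lam⟩ = 0 := by
    rw [hθ]
    generalize (-A k l).toNat = m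
    induction m with
    | zero => simp [hE]
    | succ m ih =>
      rw [pow_succ', Module.End.mul_apply, LieAlgebra.ad_apply, Ring.lie_def]
      simp [hE, ih]
  have hle : hwMod A lam ≤ (LinearMap.ker θ).map (hwMod A lam).subtype := by
    refine hwMod_le A lam ⟨_, hvac, rfl⟩ ?_
    rintro s _ - ⟨w, hw, rfl⟩
    refine ⟨hwF A lam s w, ?_, rfl⟩
    have h1 := LinearMap.congr_fun (hcomm s) w
    rw [SetLike.mem_coe, LinearMap.mem_ker] at hw ⊢
    simpa [Ring.lie_def, hw] using h1
  refine LinearMap.ext fun w => ?_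
  obtain ⟨v, hv, hvw⟩ := hle w.2
  obtain rfl : v = w := Subtype.ext hvw
  exact hv

/-- Dually, θ commutes with all e_s, and all values of θ w at the empty word vanish since each term
has an f acting last. Values at longer words reduce to this: (θ w)(sS) = (e_s θ w)(S) = (θ e_s
w)(S). -/
theorem hw_serre_f (hA : IsGCM A) {k l : Fin r} (hkl : k ≠ l) :
    (LieAlgebra.ad ℂ _ (hwF A lam k) ^ (-A k l).toNat) ⁅hwF A lam k, hwF A lam l⁆ = 0 := by
  have hcomm := (isChevalley_hw A lam).lie_e_serre hA hkl
  set θ := (LieAlgebra.ad ℂ _ (hwF A lam k) ^ (-A k l).toNat) ⁅hwF A lam k, hwF A lam l⁆ with hθ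
  have hF : ∀ s w, (hwF A lam s w : List (Fin r) → ℂ) [] = 0 := fun s w => rfl
  have hnil : ∀ w, (θ w : List (Fin r) → ℂ) [] = 0 := by
    rw [hθ]
    generalize (-A k l).toNat = m
    induction m with
    | zero => intro w; simp [hF]
    | succ m ih =>
      intro w
      rw [pow_succ', Module.End.mul_apply, LieAlgebra.ad_apply, Ring.lie_def]
      simp [hF, ih]
  refine LinearMap.ext fun w => Subtype.ext (funext fun S => ?_)
  induction S generalizing w with
  | nil => exact hnil w
  | cons s S ih =>
    have h1 := LinearMap.congr_fun (hcomm s) w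
    rw [Ring.lie_def, LinearMap.sub_apply, LinearMap.zero_apply, sub_eq_zero] at h1
    exact (congrFun (congrArg Subtype.val h1) S).trans (ih _)

/-! ### The action of 𝔤 and the vanishing of brackets outside the roots -/

/-- The images in the endomorphisms of the highest weight module of the generators of `𝔤`. -/
def hwGen : CartanMatrix.Generators (Fin r) → Module.End ℂ (hwMod A lam)
  | .H k => hwH A lam k
  | .E k => hwE A lam k
  | .F k => hwF A lam k

theorem lift_hwGen_eq_zero (hA : IsGCM A)
    {x : FreeLieAlgebra ℂ (CartanMatrix.Generators (Fin r))}
    (hx : LieSubmodule.Quotient.mk (N := CartanMatrix.Relations.toIdeal ℂ A) x = (0 : KM A)) :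
    FreeLieAlgebra.lift ℂ (hwGen A lam) x = 0 := by
  have hC := isChevalley_hw A lam
  have hle : CartanMatrix.Relations.toIdeal ℂ A ≤ (FreeLieAlgebra.lift ℂ (hwGen A lam)).ker := by
    rw [CartanMatrix.Relations.toIdeal, LieSubmodule.lieSpan_le]
    have had : ∀ (y z : FreeLieAlgebra ℂ (CartanMatrix.Generators (Fin r))) (m : ℕ),
        FreeLieAlgebra.lift ℂ (hwGen A lam) ((LieAlgebra.ad ℂ _ y ^ m) z) =
          (LieAlgebra.ad ℂ _ (FreeLieAlgebra.lift ℂ (hwGen A lam) y) ^ m)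
            (FreeLieAlgebra.lift ℂ (hwGen A lam) z) := by
      intro y z m
      induction m with
      | zero => rfl
      | succ m ih =>
        rw [pow_succ', Module.End.mul_apply, LieAlgebra.ad_apply, LieHom.map_lie, ih, pow_succ',
          Module.End.mul_apply, LieAlgebra.ad_apply]
    rintro x (((((⟨⟨k, l⟩, rfl⟩ | ⟨⟨k, l⟩, rfl⟩) | ⟨⟨k, l⟩, rfl⟩) | ⟨⟨k, l⟩, rfl⟩) |
      ⟨⟨k, l⟩, rfl⟩) | ⟨⟨k, l⟩, rfl⟩) <;> rw [SetLike.mem_coe, LieHom.mem_ker]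
    · simp [CartanMatrix.Relations.HH, hwGen, hC.lie_h_h]
    · by_cases h : k = l
      · subst h
        simp [CartanMatrix.Relations.EF, hwGen, hC.lie_e_f]
      · simp [CartanMatrix.Relations.EF, hwGen, hC.lie_e_f, h]
    · simp [CartanMatrix.Relations.HE, hwGen, hC.lie_h_e]
    · simp [CartanMatrix.Relations.HF, hwGen, hC.lie_h_f]
    -- The ideal also has diagonal relators. As `A k k = 2`, the truncated exponent is 0 there, and
    -- the relator is just ⁅e_k, e_k⁆ = 0.
    · by_cases h : k = l
      · subst h
        simp [CartanMatrix.Relations.adE, hA.diag]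
      · simp only [CartanMatrix.Relations.adE, Function.uncurry, Function.comp, had,
          LieHom.map_lie, FreeLieAlgebra.lift_of_apply, hwGen]
        exact hw_serre_e A lam hA h
    · by_cases h : k = l
      · subst h
        simp [CartanMatrix.Relations.adF, hA.diag]
      · simp only [CartanMatrix.Relations.adF, Function.uncurry, Function.comp, had,
          LieHom.map_lie, FreeLieAlgebra.lift_of_apply, hwGen]
        exact hw_serre_f A lam hA h
  have h0 : x ∈ CartanMatrix.Relations.toIdeal ℂ A :=
    (LieSubmodule.Quotient.mk_eq_zero' (N := CartanMatrix.Relations.toIdeal ℂ A)).1 hx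
  exact (LieHom.mem_ker).1 (hle h0)

/-- The iterated bracket of the generators `e_k` in the free Lie algebra, read `0` for the empty
sequence. -/
def freeBracket : List (Fin r) → FreeLieAlgebra ℂ (CartanMatrix.Generators (Fin r))
  | [] => 0
  | [s] => FreeLieAlgebra.of ℂ (CartanMatrix.Generators.E s)
  | s :: s' :: S => ⁅FreeLieAlgebra.of ℂ (CartanMatrix.Generators.E s), freeBracket (s' :: S)⁆

theorem lift_freeBracket (S : List (Fin r)) :
    FreeLieAlgebra.lift ℂ (hwGen A lam) (freeBracket S) = iterBracket (hwE A lam) S := by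
  induction S with
  | nil => simp [freeBracket, iterBracket]
  | cons s S ih =>
    cases S with
    | nil => simp [freeBracket, iterBracket, hwGen]
    | cons s' S => rw [freeBracket, iterBracket, LieHom.map_lie, ih, Ring.lie_def]; simp [hwGen]

theorem isHomogeneous_freeBracket (S : List (Fin r)) : IsHomogeneous A (rootSum S)
    (LieSubmodule.Quotient.mk (N := CartanMatrix.Relations.toIdeal ℂ A) (freeBracket S)) := by
  induction S with
  | nil => exact .zero _
  | cons s S ih =>
    cases S with
    | nil =>
      rw [show rootSum [s] = simpleRoot s by simp [rootSum]]
      exact IsHomogeneous.e s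
    | cons s' S =>
      have h := IsHomogeneous.lie (IsHomogeneous.e (A := A) s) ih
      rw [show rootSum (s :: s' :: S) = simpleRoot s + rootSum (s' :: S) by simp [rootSum]]
      exact h

/-- The bracket, formed in 𝔤, is homogeneous of degree `rootSum S`. If this nonzero degree is not a
root, the bracket is zero in 𝔤 and hence acts by zero. -/
theorem iterBracket_hwE_eq_zero (hA : IsGCM A) {S : List (Fin r)} (h0 : rootSum S ≠ 0)
    (hS : ¬ IsRoot A (rootSum S)) : iterBracket (hwE A lam) S = 0 := by
  rw [← lift_freeBracket]
  refine lift_hwGen_eq_zero A lam hA ?_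
  by_contra h
  exact hS ⟨h0, _, isHomogeneous_freeBracket A S, h⟩

theorem rootSum_ne_zero {S : List (Fin r)} (hS : S ≠ []) : rootSum S ≠ 0 := by
  have hn : ∀ S : List (Fin r), 0 ≤ rootSum S := fun S => List.sum_nonneg (by
    simp only [List.mem_map]
    rintro _ ⟨k, -, rfl⟩
    exact Pi.single_nonneg.2 zero_le_one)
  cases S with
  | nil => exact absurd rfl hS
  | cons s S =>
    intro h
    have h1 := congrFun h s
    have h2 := hn S s
    simp only [rootSum, List.map_cons, List.sum_cons, Pi.add_apply, simpleRoot, Pi.single_eq_same,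
      Pi.zero_apply] at h1 h2
    omega

theorem rootSum_reverse (S : List (Fin r)) : rootSum S.reverse = rootSum S := by
  rw [rootSum, rootSum, List.map_reverse, List.sum_reverse]

/-- The generator e_k is nonzero in 𝔤, for in the module with λ(α̌_k) = 1 it takes f_k applied to
the vacuum back to the vacuum. -/
theorem isRoot_simpleRoot (hA : IsGCM A) (k : Fin r) : IsRoot A (simpleRoot k) := by
  by_contra h
  have h1 : rootSum [k] = simpleRoot k := by simp [rootSum]
  have h2 := iterBracket_hwE_eq_zero A (fun _ => 1) hA (rootSum_ne_zero (S := [k]) (by simp))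
    (by rwa [h1])
  have h3 := LinearMap.congr_fun h2 (hwF A (fun _ => 1) k ⟨vacuum _, vacuum_mem A _⟩)
  have h4 := congrFun (congrArg Subtype.val h3) []
  simp [iterBracket, coe_hwE, coe_hwF, delOp_insOp, cartanOp_apply, vacuum, weightVal] at h4

/-- Transports brackets from the module to all functions of words, from Ṽ to coordinates, and from
one factor to the product. -/
theorem iterBracket_intertwine {K M N : Type*} [AddCommGroup M] [Module ℂ M] [AddCommGroup N]
    [Module ℂ N] (x : K → Module.End ℂ M) (y : K → Module.End ℂ N) (φ : M →ₗ[ℂ] N)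
    (h : ∀ k m, φ (x k m) = y k (φ m)) (S : List K) (m : M) :
    φ (iterBracket x S m) = iterBracket y S (φ m) := by
  induction S generalizing m with
  | nil => simp [iterBracket]
  | cons s S ih =>
    cases S with
    | nil => simp [iterBracket, h]
    | cons s' S => simp [iterBracket, h, ih]

theorem coe_iterBracket_hwE (S : List (Fin r)) (w : hwMod A lam) :
    (iterBracket (hwE A lam) S w : List (Fin r) → ℂ) = iterBracket delOp S w :=
  iterBracket_intertwine (hwE A lam) delOp (hwMod A lam).subtype (fun _ _ => rfl) S w

theorem iterBracket_delOp_eq_zero (hA : IsGCM A) {S : List (Fin r)} (h0 : rootSum S ≠ 0)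
    (hS : ¬ IsRoot A (rootSum S)) {w : List (Fin r) → ℂ} (hw : w ∈ hwMod A lam) :
    iterBracket delOp S w = 0 := by
  rw [← coe_iterBracket_hwE A lam S ⟨w, hw⟩, iterBracket_hwE_eq_zero A lam hA h0 hS]
  rfl

/-- The commutator of e_k with the bracket along `S` is the bracket along `k :: S`, which vanishes
when its weight is not a root. -/
theorem iterBracket_delOp_comm (hA : IsGCM A) {S : List (Fin r)} (h0 : S ≠ []) (k : Fin r)
    (hS : ¬ IsRoot A (rootSum S + simpleRoot k)) {w : List (Fin r) → ℂ} (hw : w ∈ hwMod A lam) :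
    iterBracket delOp S (delOp k w) = delOp k (iterBracket delOp S w) := by
  have h1 : rootSum (k :: S) = rootSum S + simpleRoot k := by simp [rootSum, add_comm]
  have h2 := iterBracket_delOp_eq_zero A lam hA (rootSum_ne_zero (S := k :: S) (by simp))
    (by rwa [h1]) hw
  cases S with
  | nil => exact absurd rfl h0
  | cons s S =>
    rw [iterBracket, LinearMap.sub_apply, sub_eq_zero] at h2
    exact h2.symm

end Words

/-! ### Arrangements of a finite set in sequences -/

section Arrangements

variable {ι : Type*} {m : ℕ}

/-- The sequences that run without repetition through `X`. -/
def arrL (X : Finset ι) : Finset (List ι) := (Multiset.lists X.val).toFinset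

theorem mem_arrL {X : Finset ι} {L : List ι} : L ∈ arrL X ↔ (L : Multiset ι) = X.val := by
  simp [arrL, eq_comm]

theorem finite_arr (m : ℕ) (X : Finset ι) :
    {J : Fin m → List ι | ∑ ν, (J ν : Multiset ι) = X.val}.Finite := by
  have h : {l : List ι | (l : Multiset ι) ≤ X.val}.Finite := by
    refine (X.val.powerset.bind Multiset.lists).toFinset.finite_toSet.subset ?_
    intro l hl
    simp only [Finset.mem_coe, Multiset.mem_toFinset, Multiset.mem_bind, Multiset.mem_powerset]
    exact ⟨l, hl, by simp⟩
  refine (Set.Finite.pi' (fun _ : Fin m => h)).subset fun J hJ ν => ?_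
  change (J ν : Multiset ι) ≤ X.val
  rw [← hJ]
  exact Finset.single_le_sum (f := fun ν => (J ν : Multiset ι)) (fun _ _ => zero_le)
    (Finset.mem_univ ν)

/-- The tuples of sequences whose juxtaposition runs without repetition through `X`. -/
def arr (m : ℕ) (X : Finset ι) : Finset (Fin m → List ι) := (finite_arr m X).toFinset

theorem mem_arr {X : Finset ι} {J : Fin m → List ι} :
    J ∈ arr m X ↔ ∑ ν, (J ν : Multiset ι) = X.val := by
  simp [arr]

theorem nodup_of_mem_arr {X : Finset ι} {J : Fin m → List ι} (hJ : J ∈ arr m X) (ν : Fin m) :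
    (J ν).Nodup := by
  rw [mem_arr] at hJ
  have h := Finset.single_le_sum (f := fun ν => (J ν : Multiset ι)) (fun _ _ => zero_le)
    (Finset.mem_univ ν)
  rw [hJ] at h
  simpa using Multiset.nodup_of_le h X.nodup

theorem exists_mem_of_mem_arr {X : Finset ι} {J : Fin m → List ι} (hJ : J ∈ arr m X) (x : ι) :
    (∃ ν, x ∈ J ν) ↔ x ∈ X := by
  rw [mem_arr] at hJ
  rw [← Finset.mem_val, ← hJ, Multiset.mem_sum]
  simp

theorem notMem_of_mem_arr {X : Finset ι} {J : Fin m → List ι} (hJ : J ∈ arr m X) {x : ι}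
    (hx : x ∉ X) (ν : Fin m) : x ∉ J ν :=
  fun h => hx ((exists_mem_of_mem_arr hJ x).1 ⟨ν, h⟩)

theorem unique_of_mem_arr {X : Finset ι} {J : Fin m → List ι} (hJ : J ∈ arr m X) {x : ι}
    {ν μ : Fin m} (hν : x ∈ J ν) (hμ : x ∈ J μ) : ν = μ := by
  by_contra h
  rw [mem_arr, ← Finset.add_sum_erase _ _ (Finset.mem_univ ν)] at hJ
  have hnd := X.nodup
  rw [← hJ, Multiset.nodup_add] at hnd
  have hν' : x ∈ (J ν : Multiset ι) := by simpa using hν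
  refine Multiset.disjoint_left.1 hnd.2.2 hν' ?_
  rw [Multiset.mem_sum]
  exact ⟨μ, by simp [Ne.symm h], by simpa using hμ⟩

theorem mem_permutations'Aux {x : ι} {L M : List ι} :
    M ∈ L.permutations'Aux x ↔ ∃ P Q, L = P ++ Q ∧ M = P ++ x :: Q := by
  induction L generalizing M with
  | nil => simp [List.permutations'Aux]
  | cons l L ih =>
    simp only [List.permutations'Aux, List.mem_cons, List.mem_map, ih]
    constructor
    · rintro (rfl | ⟨_, ⟨P, Q, rfl, rfl⟩, rfl⟩)
      · exact ⟨[], l :: L, rfl, rfl⟩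
      · exact ⟨l :: P, Q, rfl, rfl⟩
    · rintro ⟨P, Q, h1, rfl⟩
      cases P with
      | nil => left; simpa using h1.symm
      | cons p P =>
        simp only [List.cons_append, List.cons.injEq] at h1
        obtain ⟨rfl, rfl⟩ := h1
        exact Or.inr ⟨_, ⟨P, Q, rfl, rfl⟩, rfl⟩

theorem mem_permutations'Aux_iff {x : ι} {L M : List ι} (hx : x ∉ L) :
    M ∈ L.permutations'Aux x ↔ x ∈ M ∧ M.erase x = L := by
  rw [mem_permutations'Aux]
  constructor
  · rintro ⟨P, Q, rfl, rfl⟩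
    rw [List.mem_append, not_or] at hx
    simp [List.erase_append_right _ hx.1]
  · rintro ⟨h, rfl⟩
    obtain ⟨P, Q, hP, rfl, h2⟩ := List.exists_erase_eq h
    exact ⟨P, Q, h2, rfl⟩

theorem sum_arrL_insert {β : Type*} [AddCommMonoid β] {x : ι} {X : Finset ι} (hx : x ∉ X)
    (F : List ι → β) :
    ∑ M ∈ arrL (insert x X), F M = ∑ L ∈ arrL X, ((L.permutations'Aux x).map F).sum := by
  have hL : ∀ L ∈ arrL X, x ∉ L := by
    intro L hL h
    rw [mem_arrL] at hL
    exact hx (by rw [← Finset.mem_val, ← hL]; simpa using h)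
  have h1 : arrL (insert x X) = (arrL X).biUnion fun L => (L.permutations'Aux x).toFinset := by
    ext M
    simp only [Finset.mem_biUnion, List.mem_toFinset]
    constructor
    · intro hM
      rw [mem_arrL, Finset.insert_val_of_notMem hx] at hM
      have hxM : x ∈ M := by
        have : x ∈ (M : Multiset ι) := by rw [hM]; simp
        simpa using this
      have hMX : M.erase x ∈ arrL X := by
        rw [mem_arrL, ← Multiset.coe_erase, hM, Multiset.erase_cons_head]
      exact ⟨_, hMX, (mem_permutations'Aux_iff (hL _ hMX)).2 ⟨hxM, rfl⟩⟩
    · rintro ⟨L, hLX, hM⟩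
      obtain ⟨hxM, rfl⟩ := (mem_permutations'Aux_iff (hL _ hLX)).1 hM
      rw [mem_arrL] at hLX ⊢
      rw [Finset.insert_val_of_notMem hx, ← hLX, ← Multiset.coe_erase, Multiset.cons_erase]
      simpa using hxM
  rw [h1, Finset.sum_biUnion]
  · refine Finset.sum_congr rfl fun L h => ?_
    rw [List.sum_toFinset _ (List.nodup_permutations'Aux_of_notMem _ _ (hL L h))]
  · intro L hLX L' hLX' hne
    rw [Function.onFun, Finset.disjoint_left]
    intro M hM hM'
    rw [List.mem_toFinset] at hM hM'
    exact hne ((((mem_permutations'Aux_iff (hL _ hLX)).1 hM).2).symm.trans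
      ((mem_permutations'Aux_iff (hL _ hLX')).1 hM').2)

theorem coe_sum_update (J : Fin m → List ι) (ν : Fin m) (M : List ι) :
    (∑ μ, (Function.update J ν M μ : Multiset ι)) =
      M + ∑ μ ∈ Finset.univ.erase ν, (J μ : Multiset ι) := by
  rw [← Finset.add_sum_erase _ _ (Finset.mem_univ ν), Function.update_self]
  congr 1
  refine Finset.sum_congr rfl fun μ hμ => ?_
  rw [Function.update_of_ne (Finset.ne_of_mem_erase hμ)]

/-- Every arrangement of `insert x X` arises exactly once, by inserting x into one of the sequences
of an arrangement of `X`; erasing x recovers the latter. -/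
theorem sum_arr_insert {β : Type*} [AddCommMonoid β] {x : ι} {X : Finset ι} (hx : x ∉ X)
    (F : (Fin m → List ι) → β) :
    ∑ M ∈ arr m (insert x X), F M =
      ∑ J ∈ arr m X, ∑ ν, (((J ν).permutations'Aux x).map fun M => F (Function.update J ν M)).sum := by
  have hL : ∀ J ∈ arr m X, ∀ ν, x ∉ J ν := fun J hJ => notMem_of_mem_arr hJ hx
  have herase : ∀ J ∈ arr m X, ∀ ν, ∀ M ∈ (J ν).permutations'Aux x,
      (fun μ => (Function.update J ν M μ).erase x) = J := by
    intro J hJ ν M hM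
    funext μ
    by_cases hμ : μ = ν
    · subst hμ
      rw [Function.update_self]
      exact ((mem_permutations'Aux_iff (hL J hJ μ)).1 hM).2
    · rw [Function.update_of_ne hμ, List.erase_of_not_mem (hL J hJ μ)]
  have hmem : ∀ J ∈ arr m X, ∀ ν, ∀ M ∈ (J ν).permutations'Aux x, ∀ μ,
      x ∈ Function.update J ν M μ → μ = ν := by
    intro J hJ ν M hM μ h
    by_contra hμ
    rw [Function.update_of_ne hμ] at h
    exact hL J hJ μ h
  have h1 : arr m (insert x X) = (arr m X).biUnion fun J => Finset.univ.biUnion fun ν =>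
      ((J ν).permutations'Aux x).toFinset.image (Function.update J ν) := by
    ext M
    simp only [Finset.mem_biUnion, List.mem_toFinset, Finset.mem_image, Finset.mem_univ, true_and]
    constructor
    · intro hM
      obtain ⟨ν, hν⟩ := (exists_mem_of_mem_arr hM x).2 (Finset.mem_insert_self x X)
      have hJ : Function.update M ν ((M ν).erase x) ∈ arr m X := by
        rw [mem_arr, Finset.insert_val_of_notMem hx, ← Finset.add_sum_erase _ _ (Finset.mem_univ ν)]
          at hM
        rw [mem_arr, coe_sum_update, ← Multiset.coe_erase,
          ← Multiset.erase_add_left_pos _ (by simpa using hν), hM, Multiset.erase_cons_head]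
      refine ⟨_, hJ, ν, M ν, ?_, by simp⟩
      have := hL _ hJ ν
      rw [Function.update_self] at this ⊢
      exact (mem_permutations'Aux_iff this).2 ⟨hν, rfl⟩
    · rintro ⟨J, hJ, ν, M, hM, rfl⟩
      obtain ⟨hxM, hMe⟩ := (mem_permutations'Aux_iff (hL J hJ ν)).1 hM
      rw [mem_arr] at hJ ⊢
      rw [coe_sum_update, Finset.insert_val_of_notMem hx, ← hJ,
        ← Finset.add_sum_erase _ _ (Finset.mem_univ ν), ← hMe, ← Multiset.coe_erase,
        ← Multiset.cons_add, Multiset.cons_erase (by simpa using hxM)]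
  rw [h1, Finset.sum_biUnion]
  · refine Finset.sum_congr rfl fun J hJ => ?_
    rw [Finset.sum_biUnion]
    · refine Finset.sum_congr rfl fun ν _ => ?_
      rw [Finset.sum_image (Function.update_injective J ν).injOn,
        List.sum_toFinset _ (List.nodup_permutations'Aux_of_notMem _ _ (hL J hJ ν))]
    · intro ν _ μ _ hne
      rw [Function.onFun, Finset.disjoint_left]
      intro M hM hM'
      simp only [Finset.mem_image, List.mem_toFinset] at hM hM'
      obtain ⟨N, hN, rfl⟩ := hM
      obtain ⟨N', hN', h⟩ := hM'
      refine hne (hmem J hJ μ N' hN' ν ?_)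
      rw [h, Function.update_self]
      exact ((mem_permutations'Aux_iff (hL J hJ ν)).1 hN).1
  · intro J hJ J' hJ' hne
    rw [Function.onFun, Finset.disjoint_left]
    intro M hM hM'
    simp only [Finset.mem_biUnion, Finset.mem_image, List.mem_toFinset, Finset.mem_univ,
      true_and] at hM hM'
    obtain ⟨ν, N, hN, rfl⟩ := hM
    obtain ⟨μ, N', hN', h⟩ := hM'
    refine hne ?_
    rw [← herase J hJ ν N hN, ← herase J' hJ' μ N' hN', h]

end Arrangements

/-! ### Inserting a coordinate in `ζ_I` -/

section Insertion

variable {ι : Type*} {n : ℕ}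

/-- The factor by which the sum of the `c(M) ζ_M`, over the sequences `M` obtained from `L` by
inserting `x`, differs from `ζ_L`. -/
def insD (ν : Fin n) (x : ι) : (List ι → RatFn ι n) → List ι → RatFn ι n
  | c, [] => c [x] * (tc x - zc ν)⁻¹
  | c, l :: L => (c (x :: l :: L) - c (l :: x :: L)) * (tc x - tc l)⁻¹ +
      insD ν x (fun M => c (l :: M)) L

theorem coord_sub_ne_zero {a b : ι ⊕ Fin n} (h : a ≠ b) : (coord a - coord b : RatFn ι n) ≠ 0 :=
  sub_ne_zero.2 fun e => h (coord_injective e)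

theorem inl_ne_headIdx {ν : Fin n} {i : ι} {L : List ι} (h : i ∉ L) :
    Sum.inl i ≠ headIdx ν L := by
  cases L with
  | nil => simp [headIdx]
  | cons j L =>
    have : i ≠ j := fun e => h (by simp [e])
    simpa [headIdx] using this

/-- The partial fraction 1/((l - x)(x - h)) = (1/(x - h) - 1/(x - l))/(l - h), where h is the head
of `L`. -/
theorem zetaSeq_cons_cons (ν : Fin n) {x l : ι} {L : List ι} (hx : x ∉ L) (hl : l ∉ L)
    (hxl : x ≠ l) :
    zetaSeq ν (l :: x :: L) = (tc l - coord (headIdx ν L))⁻¹ * (zetaSeq ν (x :: L) -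
      (tc x - tc l)⁻¹ * zetaSeq ν L) := by
  have h1 := coord_sub_ne_zero (n := n) (inl_ne_headIdx (ν := ν) hx)
  have h2 := coord_sub_ne_zero (n := n) (inl_ne_headIdx (ν := ν) hl)
  have h3 : (coord (Sum.inl x) - coord (Sum.inl l) : RatFn ι n) ≠ 0 :=
    coord_sub_ne_zero (by simpa using hxl)
  have h4 : (coord (Sum.inl l) - coord (Sum.inl x) : RatFn ι n) ≠ 0 :=
    coord_sub_ne_zero (by simpa using hxl.symm)
  simp only [zetaSeq, tc]
  rw [show headIdx ν (x :: L) = Sum.inl x from rfl]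
  field_simp
  ring

/-- The source of all residue formulas. Only the factor `insD` contains t_x, and it is already
decomposed into simple poles at the t_l and at z_ν. -/
theorem sum_insert_zetaSeq (ν : Fin n) {x : ι} {L : List ι} (hL : L.Nodup) (hx : x ∉ L)
    (c : List ι → RatFn ι n) :
    ((L.permutations'Aux x).map fun M => c M * zetaSeq ν M).sum = insD ν x c L * zetaSeq ν L := by
  induction L generalizing c with
  | nil => simp [List.permutations'Aux, zetaSeq, insD, headIdx, tc, zc]
  | cons l L ih =>
    obtain ⟨hl, hL'⟩ := List.nodup_cons.1 hL
    rw [List.mem_cons, not_or] at hx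
    have h1 := ih hL' hx.2 fun M => c (l :: M)
    -- All insertions except the one at the front keep the head of `L`, so putting l before them
    -- multiplies by a common factor. The front insertion is the one that needs the partial
    -- fraction.
    obtain ⟨T, hT, hhead⟩ : ∃ T, L.permutations'Aux x = (x :: L) :: T ∧
        ∀ M ∈ T, headIdx ν M = headIdx ν L := by
      cases L with
      | nil => exact ⟨[], rfl, by simp⟩
      | cons l' L =>
        refine ⟨_, rfl, ?_⟩
        intro M hM
        obtain ⟨N, -, rfl⟩ := List.mem_map.1 hM
        rfl
    have h2 : (T.map fun M => c (l :: M) * zetaSeq ν (l :: M)) =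
        (T.map fun M => c (l :: M) * zetaSeq ν M).map ((tc l - coord (headIdx ν L))⁻¹ * ·) := by
      rw [List.map_map]
      refine List.map_congr_left fun M hM => ?_
      rw [zetaSeq, hhead M hM, Function.comp]
      ring
    rw [hT, List.map_cons, List.sum_cons] at h1
    rw [List.permutations'Aux, List.map_cons, List.sum_cons, List.map_map, hT, List.map_cons,
      List.sum_cons, insD]
    rw [show ((fun M => c M * zetaSeq ν M) ∘ List.cons l) =
      fun M => c (l :: M) * zetaSeq ν (l :: M) from rfl, h2, List.sum_map_mul_left, List.map_id']
    beta_reduce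
    rw [zetaSeq_cons_cons ν hx.2 hl hx.1]
    rw [show zetaSeq ν (x :: l :: L) = (tc x - tc l)⁻¹ * zetaSeq ν (l :: L) from rfl,
      show zetaSeq ν (l :: L) = (tc l - coord (headIdx ν L))⁻¹ * zetaSeq ν L from rfl]
    linear_combination (tc l - coord (headIdx ν L))⁻¹ * h1

end Insertion

/-! ### Rational functions that do not involve a coordinate -/

section Constants

variable {ι : Type*} {n : ℕ}

/-- The rational functions that do not involve `t_x`. -/
def noVar (n : ℕ) (x : ι) : Subfield (RatFn ι n) :=
  Subfield.closure (Set.range (algebraMap ℂ (RatFn ι n)) ∪ {g | ∃ j, j ≠ Sum.inl x ∧ g = coord j})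

theorem coord_mem_noVar {x : ι} {j : ι ⊕ Fin n} (h : j ≠ Sum.inl x) : coord j ∈ noVar n x :=
  Subfield.subset_closure (Or.inr ⟨j, h, rfl⟩)

theorem algebraMap_mem_noVar (x : ι) (c : ℂ) : algebraMap ℂ (RatFn ι n) c ∈ noVar n x :=
  Subfield.subset_closure (Or.inl ⟨c, rfl⟩)

theorem zetaSeq_mem_noVar {x : ι} (ν : Fin n) {L : List ι} (hx : x ∉ L) :
    zetaSeq ν L ∈ noVar n x := by
  induction L with
  | nil => exact one_mem _
  | cons l L ih =>
    rw [List.mem_cons, not_or] at hx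
    exact mul_mem (inv_mem (sub_mem (coord_mem_noVar (by simpa using Ne.symm hx.1))
      (coord_mem_noVar (inl_ne_headIdx hx.2).symm))) (ih hx.2)

/-- The expansion and the constant embedding agree on constants and on the other coordinates, hence
on the subfield these generate. -/
theorem expand_of_mem_noVar {x : ι} {s : LaurentSeries (RatFn ι n)} (hs : Substitutable s)
    {g : RatFn ι n} (hg : g ∈ noVar n x) : expand x s hs g = HahnSeries.C g := by
  have h : noVar n x ≤ RingHom.eqLocusField (expand x s hs) HahnSeries.C := by
    refine Subfield.closure_le.2 ?_
    rintro _ (⟨c, rfl⟩ | ⟨j, hj, rfl⟩)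
    · have : (algebraMap ℂ (RatFn ι n) c) = algebraMap (Poly ι n) _ (MvPolynomial.C c) := rfl
      change expand x s hs (algebraMap ℂ (RatFn ι n) c) = _
      conv_lhs => rw [this, expand_algebraMap]
      simp [substPoly]
    · change expand x s hs (coord j) = _
      conv_lhs => rw [coord, expand_algebraMap]
      simp [substPoly, hj]
  exact h hg

theorem resFn_mul_of_mem_noVar {x : ι} (a g : RatFn ι n) {h : RatFn ι n} (hh : h ∈ noVar n x) :
    resFn x a (h * g) = h * resFn x a g := by
  rw [resFn, map_mul, expandAt, expand_of_mem_noVar _ hh, HahnSeries.C_mul_eq_smul,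
    HahnSeries.coeff_smul, smul_eq_mul]
  rfl

theorem resFn_sum {α : Type*} (x : ι) (a : RatFn ι n) (T : Finset α) (g : α → RatFn ι n) :
    resFn x a (∑ i ∈ T, g i) = ∑ i ∈ T, resFn x a (g i) :=
  map_sum (resLin x a) g T

theorem resFn_add (x : ι) (a g h : RatFn ι n) :
    resFn x a (g + h) = resFn x a g + resFn x a h :=
  map_add (resLin x a) g h

theorem resFn_zero (x : ι) (a : RatFn ι n) : resFn x a 0 = 0 := map_zero (resLin x a)

theorem resFn_inv_sub {x : ι} (k : ι ⊕ Fin n) {j : ι ⊕ Fin n} (hj : j ≠ Sum.inl x) :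
    resFn x (coord k) ((coord (Sum.inl x) - coord j)⁻¹ : RatFn ι n) = if j = k then 1 else 0 := by
  rw [resFn, map_inv₀, map_sub, expandAt_coord, expandAt_coord, if_pos rfl, if_neg hj]
  split_ifs with h
  · subst h
    simp [HahnSeries.inv_single]
  · have h1 : IsReg (HahnSeries.C (coord k) + HahnSeries.single (1 : ℤ) 1 :
        LaurentSeries (RatFn ι n)) (coord k) :=
      ⟨PowerSeries.C (coord k) + PowerSeries.X, by simp, by simp⟩
    exact ((h1.sub (isReg_C (coord j))).inv (coord_sub_ne_zero (Ne.symm h))).coeff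

end Constants

/-! ### Forms given by operators -/

section OperatorForms

variable {ι K : Type*} {n : ℕ}

/-- The value at the empty word of the result of applying the operators `X_l` to `w`, where `l`
runs through the terms of a sequence, the first term being the first to act. -/
def runVal (X : ι → Module.End ℂ (List K → ℂ)) : (List K → ℂ) → List ι → ℂ
  | w, [] => w []
  | w, l :: L => runVal X (X l w) L

theorem runVal_sub (X : ι → Module.End ℂ (List K → ℂ)) (v w : List K → ℂ) (L : List ι) :
    runVal X (v - w) L = runVal X v L - runVal X w L := by
  induction L generalizing v w with
  | nil => rfl
  | cons l L ih => simp only [runVal, map_sub, ih]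

theorem runVal_congr {X X' : ι → Module.End ℂ (List K → ℂ)} (w : List K → ℂ) {L : List ι}
    (h : ∀ l ∈ L, X l = X' l) : runVal X w L = runVal X' w L := by
  induction L generalizing w with
  | nil => rfl
  | cons l L ih =>
    rw [runVal, runVal, h l (by simp), ih _ fun l hl => h l (by simp [hl])]

theorem runVal_delOp {r : ℕ} (π : ι → Fin r) (w : List (Fin r) → ℂ) (L : List ι) :
    runVal (fun i => delOp (π i)) w L = w (L.map π) := by
  induction L generalizing w with
  | nil => rfl
  | cons l L ih => rw [runVal, ih]; rfl

/-- The polydifferential whose coefficient on a tuple of sequences is the product of the values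
of `runVal`. -/
def opForm (X : ι → Module.End ℂ (List K → ℂ)) (w : Fin n → List K → ℂ) : Form ι n :=
  fun S => ∑ J ∈ arr n S, ∏ ν, (algebraMap ℂ _ (runVal X (w ν) (J ν)) * zetaSeq ν (J ν))

theorem opForm_insert (X : ι → Module.End ℂ (List K → ℂ)) (w : Fin n → List K → ℂ) {x : ι}
    {S : Finset ι} (hx : x ∉ S) :
    opForm X w (insert x S) = ∑ J ∈ arr n S, ∑ ν,
      ((∏ μ ∈ Finset.univ.erase ν, algebraMap ℂ _ (runVal X (w μ) (J μ)) * zetaSeq μ (J μ)) *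
        zetaSeq ν (J ν)) * insD ν x (fun M => algebraMap ℂ _ (runVal X (w ν) M)) (J ν) := by
  rw [opForm, sum_arr_insert hx]
  refine Finset.sum_congr rfl fun J hJ => Finset.sum_congr rfl fun ν _ => ?_
  rw [mul_assoc, mul_comm (zetaSeq ν (J ν)), ← sum_insert_zetaSeq ν (nodup_of_mem_arr hJ ν)
    (notMem_of_mem_arr hJ hx ν), ← List.sum_map_mul_left]
  congr 1
  refine List.map_congr_left fun M _ => ?_
  rw [← Finset.mul_prod_erase _ _ (Finset.mem_univ ν), Function.update_self, mul_comm]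
  congr 1
  refine Finset.prod_congr rfl fun μ hμ => ?_
  rw [Function.update_of_ne (Finset.ne_of_mem_erase hμ)]

/-- The effect on a family of operators of taking a residue along `t_x = t_y`. -/
def residueOps (x y : ι) (X : ι → Module.End ℂ (List K → ℂ)) : ι → Module.End ℂ (List K → ℂ) :=
  Function.update X y (X y * X x - X x * X y)

/-- Only the summand with pole t_x = t_y has a residue. Its numerator compares inserting x just
before and just after y, which is the commutator of X_y and X_x at the place of y. -/
theorem resFn_insD (ν : Fin n) {x : ι} (y : ι) (X : ι → Module.End ℂ (List K → ℂ))
    (w : List K → ℂ) {L : List ι} (hL : L.Nodup) (hx : x ∉ L) :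
    resFn x (tc y) (insD ν x (fun M => algebraMap ℂ _ (runVal X w M)) L) =
      if y ∈ L then algebraMap ℂ _ (runVal (residueOps x y X) w L) else 0 := by
  induction L generalizing w with
  | nil =>
    rw [insD, resFn_mul_of_mem_noVar _ _ (algebraMap_mem_noVar _ _), tc, zc, tc,
      resFn_inv_sub _ (Sum.inr_ne_inl)]
    simp
  | cons l L ih =>
    obtain ⟨hl, hL'⟩ := List.nodup_cons.1 hL
    rw [List.mem_cons, not_or] at hx
    have hlx : (Sum.inl l : ι ⊕ Fin n) ≠ Sum.inl x := by simpa using Ne.symm hx.1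
    rw [insD, resFn_add, ← map_sub, resFn_mul_of_mem_noVar _ _ (algebraMap_mem_noVar _ _)]
    have h1 := ih hL' hx.2 (w := X l w)
    simp only [runVal] at h1 ⊢
    rw [h1, tc, tc, tc, resFn_inv_sub _ hlx]
    by_cases hy : l = y
    · subst hy
      have h2 : ∀ i ∈ L, residueOps x l X i = X i := fun i hi =>
        Function.update_of_ne (fun e => hl (by rwa [← e])) _ _
      rw [if_neg hl, if_pos rfl, if_pos (by simp), runVal_congr _ h2, ← runVal_sub]
      simp [residueOps]
    · rw [if_neg (by simpa using hy), mul_zero, zero_add]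
      have h2 : residueOps x y X l = X l := Function.update_of_ne hy _ _
      simp only [List.mem_cons, Ne.symm hy, false_or, h2]

/-- In each arrangement y occurs in at most one sequence, so just one factor has a residue, and
replacing X_y leaves the other factors unchanged. If dt_y is absent, so is t_y, and there is no pole
along t_x = t_y. -/
theorem resFn_opForm (X : ι → Module.End ℂ (List K → ℂ)) (w : Fin n → List K → ℂ) {x y : ι}
    {S : Finset ι} (hx : x ∉ S) : resFn x (tc y) (opForm X w (insert x S)) =
      if y ∈ S then opForm (residueOps x y X) w S else 0 := by
  rw [opForm_insert X w hx, resFn_sum]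
  have key : ∀ J ∈ arr n S, resFn x (tc y) (∑ ν,
      ((∏ μ ∈ Finset.univ.erase ν, algebraMap ℂ _ (runVal X (w μ) (J μ)) * zetaSeq μ (J μ)) *
        zetaSeq ν (J ν)) * insD ν x (fun M => algebraMap ℂ _ (runVal X (w ν) M)) (J ν)) =
      ∑ ν, if y ∈ J ν then
        ∏ μ, (algebraMap ℂ _ (runVal (residueOps x y X) (w μ) (J μ)) * zetaSeq μ (J μ)) else 0 := by
    intro J hJ
    rw [resFn_sum]
    refine Finset.sum_congr rfl fun ν _ => ?_
    have hxJ := notMem_of_mem_arr hJ hx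
    rw [resFn_mul_of_mem_noVar _ _ (mul_mem (prod_mem fun μ _ => mul_mem
      (algebraMap_mem_noVar _ _) (zetaSeq_mem_noVar μ (hxJ μ))) (zetaSeq_mem_noVar ν (hxJ ν))),
      resFn_insD ν y X (w ν) (nodup_of_mem_arr hJ ν) (hxJ ν)]
    split_ifs with hy
    · rw [← Finset.mul_prod_erase _ _ (Finset.mem_univ ν), mul_assoc, mul_comm,
        mul_comm (zetaSeq ν (J ν))]
      congr 1
      refine Finset.prod_congr rfl fun μ hμ => ?_
      rw [runVal_congr (X' := residueOps x y X)]
      intro l hl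
      refine (Function.update_of_ne (fun e => ?_) _ _).symm
      subst e
      exact Finset.ne_of_mem_erase hμ (unique_of_mem_arr hJ hl hy)
    · rw [mul_zero]
  rw [Finset.sum_congr rfl key]
  split_ifs with hy
  · refine Finset.sum_congr rfl fun J hJ => ?_
    obtain ⟨ν, hν⟩ := (exists_mem_of_mem_arr hJ y).2 hy
    rw [Finset.sum_eq_single ν, if_pos hν]
    · intro μ _ hne
      exact if_neg fun hμ => hne (unique_of_mem_arr hJ hμ hν)
    · simp
  · refine Finset.sum_eq_zero fun J hJ => Finset.sum_eq_zero fun ν _ => ?_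
    exact if_neg (notMem_of_mem_arr hJ hy ν)

end OperatorForms

/-! ### Iterated residues -/

section IteratedResidues

variable {ι K : Type*} {n : ℕ}

/-- The iterated residue on coefficients. -/
def resChain : List ι → RatFn ι n → RatFn ι n
  | [], g => g
  | [_], g => g
  | x :: y :: I, g => resChain (y :: I) (resFn x (tc y) g)

theorem resChain_zero (I : List ι) : resChain I (0 : RatFn ι n) = 0 := by
  induction I with
  | nil => rfl
  | cons x I ih =>
    cases I with
    | nil => rfl
    | cons y I => rw [resChain, resFn_zero, ih]

theorem formResSeq_apply {I : List ι} (hI : I.Nodup) (ω : Form ι n) (S : Finset ι) :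
    formResSeq I ω S = if ∀ i ∈ I.dropLast, i ∉ S then
      resChain I (ω (S ∪ I.dropLast.toFinset)) else 0 := by
  induction I generalizing ω with
  | nil => simp [formResSeq, resChain]
  | cons x I ih =>
    cases I with
    | nil => simp [formResSeq, resChain]
    | cons y I =>
      obtain ⟨hx, hI'⟩ := List.nodup_cons.1 hI
      have hxT : x ∉ (y :: I).dropLast := fun h => hx (List.dropLast_subset _ h)
      rw [formResSeq, ih hI', List.dropLast_cons_cons, formRes, resChain]
      by_cases hS : x ∈ S
      · rw [if_pos (Finset.mem_union_left _ hS), resChain_zero, ite_self, if_neg]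
        exact fun h => h x (by simp) hS
      · have hxU : x ∉ S ∪ (y :: I).dropLast.toFinset := by
          rw [Finset.mem_union, List.mem_toFinset, not_or]
          exact ⟨hS, hxT⟩
        rw [if_neg hxU]
        simp only [List.mem_cons, forall_eq_or_imp, hS, not_false_eq_true, true_and,
          List.toFinset_cons, Finset.union_insert]

/-- The effect on a family of operators of the iterated residue along a sequence. -/
def chainOps : List ι → (ι → Module.End ℂ (List K → ℂ)) → ι → Module.End ℂ (List K → ℂ)
  | [], X => X
  | [_], X => X
  | x :: y :: I, X => chainOps (y :: I) (residueOps x y X)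

theorem chainOps_of_notMem {I : List ι} {j : ι} (hj : j ∉ I) (X : ι → Module.End ℂ (List K → ℂ)) :
    chainOps I X j = X j := by
  induction I generalizing X with
  | nil => rfl
  | cons x I ih =>
    cases I with
    | nil => rfl
    | cons y I =>
      rw [List.mem_cons, not_or] at hj
      rw [chainOps, ih hj.2, residueOps, Function.update_of_ne]
      rintro rfl
      simp at hj

/-- A residue lengthens the bracket at its innermost end: the entry y becomes [X_y, X_x]. As y does
not occur in `L`, the outer entries stay the same. -/
theorem iterBracket_residueOps {x y : ι} (X : ι → Module.End ℂ (List K → ℂ)) {L : List ι}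
    (hy : y ∉ L) :
    iterBracket (residueOps x y X) (L ++ [y]) = iterBracket X (L ++ [y, x]) := by
  induction L with
  | nil => simp [iterBracket, residueOps]
  | cons l L ih =>
    rw [List.mem_cons, not_or] at hy
    have hl : residueOps x y X l = X l := Function.update_of_ne (Ne.symm hy.1) _ _
    cases L with
    | nil =>
      have := ih hy.2
      simp only [List.nil_append] at this
      simp only [List.cons_append, List.nil_append, iterBracket, hl] at this ⊢
      rw [this]
    | cons l' L =>
      have := ih hy.2
      simp only [List.cons_append] at this ⊢
      rw [iterBracket, iterBracket, hl, this]

theorem chainOps_getLast {I : List ι} (hI : I ≠ []) (hnd : I.Nodup)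
    (X : ι → Module.End ℂ (List K → ℂ)) :
    chainOps I X (I.getLast hI) = iterBracket X I.reverse := by
  induction I generalizing X with
  | nil => exact absurd rfl hI
  | cons x I ih =>
    cases I with
    | nil => rfl
    | cons y I =>
      have hnd' := (List.nodup_cons.1 hnd).2
      rw [chainOps, List.getLast_cons (List.cons_ne_nil y I), ih (by simp) hnd', List.reverse_cons,
        iterBracket_residueOps _ (by simpa using (List.nodup_cons.1 hnd').1)]
      simp

/-- At least one residue must be taken for the components without dt at the last index to vanish.
For a singleton they survive, which explains the case of length one in the later formulas. -/
theorem resChain_opForm {I : List ι} (hI : I ≠ []) (hnd : I.Nodup) (h2 : 2 ≤ I.length)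
    (X : ι → Module.End ℂ (List K → ℂ)) (w : Fin n → List K → ℂ) {S : Finset ι}
    (hS : ∀ i ∈ I.dropLast, i ∉ S) :
    resChain I (opForm X w (S ∪ I.dropLast.toFinset)) =
      if I.getLast hI ∈ S then opForm (chainOps I X) w S else 0 := by
  induction I generalizing X with
  | nil => exact absurd rfl hI
  | cons x I ih =>
    cases I with
    | nil => simp at h2
    | cons y I =>
      obtain ⟨hx, hnd'⟩ := List.nodup_cons.1 hnd
      have hxT : x ∉ (y :: I).dropLast := fun h => hx (List.dropLast_subset _ h)
      rw [List.dropLast_cons_cons] at hS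
      rw [List.dropLast_cons_cons, resChain, List.toFinset_cons, Finset.union_insert, resFn_opForm X w
        (by rw [Finset.mem_union, List.mem_toFinset, not_or]
            exact ⟨hS x (List.mem_cons_self), hxT⟩), List.getLast_cons (List.cons_ne_nil y I), chainOps]
      cases I with
      | nil =>
        simp only [List.dropLast_singleton, List.toFinset_nil, Finset.union_empty, resChain,
          chainOps, List.getLast_singleton]
        by_cases hy : y ∈ S <;> simp [hy]
      | cons z I =>
        -- The index y is not the last one, so its differential is still present in the component
        -- being evaluated.
        rw [if_pos (by simp), ih (by simp) hnd' (by simp) _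
          fun i hi => hS i (List.mem_cons_of_mem _ hi)]

theorem formResSeq_opForm {I : List ι} (hI : I ≠ []) (hnd : I.Nodup)
    (X : ι → Module.End ℂ (List K → ℂ)) (w : Fin n → List K → ℂ) (S : Finset ι) :
    formResSeq I (opForm X w) S = if ∀ i ∈ I.dropLast, i ∉ S then
      if I.getLast hI ∈ S then opForm (chainOps I X) w S
      else if I.length = 1 then opForm X w S else 0 else 0 := by
  rw [formResSeq_apply hnd]
  by_cases hS : ∀ i ∈ I.dropLast, i ∉ S
  · rw [if_pos hS, if_pos hS]
    by_cases h1 : I.length = 1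
    · obtain ⟨x, rfl⟩ := List.length_eq_one_iff.1 h1
      simp [resChain, chainOps]
    · rw [if_neg h1]
      have := List.length_pos_iff.2 hI
      exact resChain_opForm hI hnd (by omega) X w hS
  · rw [if_neg hS, if_neg hS]

end IteratedResidues

/-! ### Forms given by functions of words -/

section WordForms

variable {ι : Type*} {n r : ℕ}

/-- The polydifferential in the single base coordinate `z_ν` given by a function of words. -/
def wordForm (π : ι → Fin r) (ν : Fin n) : (List (Fin r) → ℂ) →ₗ[ℂ] Form ι n where
  toFun w X := ∑ L ∈ arrL X, algebraMap ℂ _ (w (L.map π)) * zetaSeq ν L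
  map_add' v w := by
    funext X
    simp only [Pi.add_apply, map_add, add_mul, Finset.sum_add_distrib]
  map_smul' c w := by
    funext X
    simp only [Pi.smul_apply, smul_eq_mul, map_mul, Algebra.smul_def, RingHom.id_apply,
      Finset.mul_sum, mul_assoc]

theorem wordForm_apply (π : ι → Fin r) (ν : Fin n) (w : List (Fin r) → ℂ) (X : Finset ι) :
    wordForm π ν w X = ∑ L ∈ arrL X, algebraMap ℂ _ (w (L.map π)) * zetaSeq ν L := rfl

/-- The polydifferential given by a function of tuples of words. -/
def tupleForm (n : ℕ) (π : ι → Fin r) : ((Fin n → List (Fin r)) → ℂ) →ₗ[ℂ] Form ι n where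
  toFun g X := ∑ J ∈ arr n X, algebraMap ℂ _ (g fun ν => (J ν).map π) * zetaTuple J
  map_add' v w := by
    funext X
    simp only [Pi.add_apply, map_add, add_mul, Finset.sum_add_distrib]
  map_smul' c w := by
    funext X
    simp only [Pi.smul_apply, smul_eq_mul, map_mul, Algebra.smul_def, RingHom.id_apply,
      Finset.mul_sum, mul_assoc]

theorem tupleForm_apply (π : ι → Fin r) (g : (Fin n → List (Fin r)) → ℂ) (X : Finset ι) :
    tupleForm n π g X = ∑ J ∈ arr n X, algebraMap ℂ _ (g fun ν => (J ν).map π) * zetaTuple J := rfl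

/-- The product of functions of words, as a function of tuples of words. -/
def pureFn (w : Fin n → List (Fin r) → ℂ) : (Fin n → List (Fin r)) → ℂ :=
  fun S => ∏ ν, w ν (S ν)

theorem tupleForm_pureFn (π : ι → Fin r) (w : Fin n → List (Fin r) → ℂ) (X : Finset ι) :
    tupleForm n π (pureFn w) X =
      ∑ J ∈ arr n X, ∏ ν, (algebraMap ℂ _ (w ν ((J ν).map π)) * zetaSeq ν (J ν)) := by
  rw [tupleForm_apply]
  refine Finset.sum_congr rfl fun J _ => ?_
  rw [pureFn, zetaTuple, map_prod, Finset.prod_mul_distrib]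

theorem opForm_delOp (π : ι → Fin r) (w : Fin n → List (Fin r) → ℂ) :
    opForm (fun i => delOp (π i)) w = tupleForm n π (pureFn w) := by
  funext X
  rw [tupleForm_pureFn, opForm]
  simp only [runVal_delOp]

/-! #### The operators `f_k` -/

/-- The coefficient with which the term `i` of a sequence contributes to `f_k w`. -/
def insWeight (A : Matrix (Fin r) (Fin r) ℤ) (π : ι → Fin r) (lam : Fin r → ℂ) (k : Fin r) (i : ι) :
    List ι → ℂ
  | [] => 0
  | l :: L => if l = i then weightVal A lam k (L.map π) else insWeight A π lam k i L

theorem insOp_map (A : Matrix (Fin r) (Fin r) ℤ) (π : ι → Fin r) (lam : Fin r → ℂ) (k : Fin r)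
    (w : List (Fin r) → ℂ) {L : List ι} (hL : L.Nodup) :
    insOp A lam k w (L.map π) = ∑ i ∈ L.toFinset,
      if π i = k then insWeight A π lam k i L * w ((L.erase i).map π) else 0 := by
  induction L generalizing w with
  | nil => simp
  | cons l L ih =>
    obtain ⟨hl, hL'⟩ := List.nodup_cons.1 hL
    rw [List.toFinset_cons, Finset.sum_insert (by simpa using hl), List.map_cons, insOp_cons,
      ih _ hL', add_comm]
    congr 1
    · simp [insWeight]
    · refine Finset.sum_congr rfl fun i hi => ?_
      have hil : l ≠ i := fun e => hl (by rw [e]; simpa using hi)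
      rw [insWeight, if_neg hil, List.erase_cons_tail (by simpa using hil)]
      rfl

/-- Moving i from just before l to just after l drops α_l from the weight to its right, so the
numerator at t_i = t_l is -c_{k,l}. At z_ν nothing is to the right of i, and the numerator is
λ(α̌_k). -/
theorem insD_insWeight (A : Matrix (Fin r) (Fin r) ℤ) (π : ι → Fin r) (lam : Fin r → ℂ)
    (k : Fin r) (ν : Fin n) {i : ι} {L : List ι} (hL : L.Nodup) (hi : i ∉ L) :
    insD ν i (fun M => algebraMap ℂ (RatFn ι n) (insWeight A π lam k i M)) L =
      algebraMap ℂ _ (lam k) / (tc i - zc ν) -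
        ∑ j ∈ L.toFinset, (A k (π j) : RatFn ι n) / (tc i - tc j) := by
  induction L with
  | nil => simp [insD, insWeight, weightVal, div_eq_mul_inv]
  | cons l L ih =>
    obtain ⟨hl, hL'⟩ := List.nodup_cons.1 hL
    rw [List.mem_cons, not_or] at hi
    have h1 : (fun M => algebraMap ℂ (RatFn ι n) (insWeight A π lam k i (l :: M))) =
        fun M => algebraMap ℂ (RatFn ι n) (insWeight A π lam k i M) := by
      funext M
      rw [insWeight, if_neg (Ne.symm hi.1)]
    have h2 : algebraMap ℂ (RatFn ι n) (insWeight A π lam k i (i :: l :: L)) -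
        algebraMap ℂ (RatFn ι n) (insWeight A π lam k i (l :: i :: L)) =
        -(A k (π l) : RatFn ι n) := by
      simp only [insWeight, if_neg (Ne.symm hi.1), if_true]
      rw [← map_sub, List.map_cons, weightVal_cons]
      simp
    rw [insD, h1, h2, ih hL' hi.2, List.toFinset_cons, Finset.sum_insert (by simpa using hl)]
    ring

theorem toFinset_of_mem_arrL {X : Finset ι} {L : List ι} (hL : L ∈ arrL X) : L.toFinset = X := by
  rw [mem_arrL] at hL
  ext i
  rw [List.mem_toFinset, ← Finset.mem_val, ← hL, Multiset.mem_coe]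

theorem nodup_of_mem_arrL {X : Finset ι} {L : List ι} (hL : L ∈ arrL X) : L.Nodup := by
  rw [← Multiset.coe_nodup, mem_arrL.1 hL]
  exact X.nodup

/-- Both sides are sorted by the index i that f_k inserts. For fixed i, summing over its positions
in each sequence turns the insertion weights into the rational factor of Φ_i. -/
theorem fOp_wordForm (A : Matrix (Fin r) (Fin r) ℤ) (π : ι → Fin r) (lam : Fin r → ℝ) (ν : Fin n)
    (k : Fin r) (w : List (Fin r) → ℂ) :
    fOp A π lam ν k (wordForm π ν w) = wordForm π ν (insOp A (fun k => (lam k : ℂ)) k w) := by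
  funext X
  have h1 : wordForm π ν (insOp A (fun k => (lam k : ℂ)) k w) X = ∑ i ∈ X with π i = k,
      ∑ L ∈ arrL X, algebraMap ℂ (RatFn ι n)
        (insWeight A π (fun k => (lam k : ℂ)) k i L * w ((L.erase i).map π)) * zetaSeq ν L := by
    rw [wordForm_apply, Finset.sum_comm]
    refine Finset.sum_congr rfl fun L hL => ?_
    rw [insOp_map A π _ k w (nodup_of_mem_arrL hL), (toFinset_of_mem_arrL hL), ← Finset.sum_filter, map_sum,
      Finset.sum_mul]
  rw [h1, fOp]
  refine Finset.sum_congr rfl fun i hi => ?_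
  obtain ⟨hiX, rfl⟩ := Finset.mem_filter.1 hi
  obtain ⟨Y, hiY, rfl⟩ : ∃ Y, i ∉ Y ∧ insert i Y = X :=
    ⟨X.erase i, by simp, Finset.insert_erase hiX⟩
  rw [phiOp, if_pos hiX, sum_arrL_insert hiY, Finset.erase_insert hiY, wordForm_apply,
    Finset.mul_sum]
  refine Finset.sum_congr rfl fun L hL => ?_
  have hiL : i ∉ L := fun h => hiY (by rw [← toFinset_of_mem_arrL hL]; simpa using h)
  rw [← toFinset_of_mem_arrL hL, ← insD_insWeight A π (fun k => (lam k : ℂ)) (π i) ν (nodup_of_mem_arrL hL) hiL, mul_left_comm,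
    ← sum_insert_zetaSeq ν (nodup_of_mem_arrL hL) hiL, ← List.sum_map_mul_left]
  congr 1
  refine List.map_congr_left fun M hM => ?_
  rw [((mem_permutations'Aux_iff hiL).1 hM).2, map_mul]
  ring

theorem arrL_empty : arrL (∅ : Finset ι) = {[]} := by
  ext L
  rw [mem_arrL]
  simp

theorem wordForm_vacuum (π : ι → Fin r) (ν : Fin n) : wordForm π ν (vacuum _) = formOne := by
  funext X
  rw [wordForm_apply, formOne]
  split_ifs with hX
  · subst hX
    simp [arrL_empty, vacuum, zetaSeq]
  · refine Finset.sum_eq_zero fun L hL => ?_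
    have : L ≠ [] := by
      rintro rfl
      rw [mem_arrL] at hL
      exact hX (Finset.val_eq_zero.1 hL.symm)
    simp [vacuum, this]

/-- The image of the module contains 1 and is stable under the f_k. This inclusion suffices, since
only properties of all elements of V(λ) are to be proved. -/
theorem factorV_le (A : Matrix (Fin r) (Fin r) ℤ) (π : ι → Fin r) (lam : Fin r → ℝ) (ν : Fin n) :
    factorV A π lam ν ≤ (hwMod A fun k => (lam k : ℂ)).map (wordForm π ν) := by
  refine sInf_le ⟨⟨_, vacuum_mem _ _, wordForm_vacuum π ν⟩, ?_⟩
  rintro k _ ⟨w, hw, rfl⟩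
  exact ⟨_, insOp_mem _ _ k hw, (fOp_wordForm A π lam ν k w).symm⟩

/-! #### Products -/

/-- Splits off the first sequence, with underlying set Y, to match the recursive form of the product
of polydifferentials. -/
theorem sum_arr_succ {β : Type*} [AddCommMonoid β] {m : ℕ} (X : Finset ι)
    (F : (Fin (m + 1) → List ι) → β) :
    ∑ J ∈ arr (m + 1) X, F J =
      ∑ Y ∈ X.powerset, ∑ L ∈ arrL Y, ∑ J ∈ arr m (X \ Y), F (Fin.cons L J) := by
  have hval : ∀ J ∈ arr (m + 1) X, (J 0 : Multiset ι) = (J 0).toFinset.val := fun J hJ => by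
    rw [List.toFinset_val, (nodup_of_mem_arr hJ 0).dedup]
  have hmaps : ∀ J ∈ arr (m + 1) X, (J 0).toFinset ∈ X.powerset := by
    intro J hJ
    rw [Finset.mem_powerset]
    intro i hi
    exact (exists_mem_of_mem_arr hJ i).1 ⟨0, by simpa using hi⟩
  rw [← Finset.sum_fiberwise_of_maps_to hmaps]
  refine Finset.sum_congr rfl fun Y hY => ?_
  rw [← Finset.sum_product']
  refine Finset.sum_nbij' (fun J => (J 0, Fin.tail J)) (fun p => Fin.cons p.1 p.2) ?_ ?_ ?_ ?_ ?_
  · intro J hJ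
    obtain ⟨hJX, rfl⟩ := Finset.mem_filter.1 hJ
    have h0 := hval J hJX
    rw [Finset.mem_product, mem_arrL, mem_arr]
    refine ⟨h0, ?_⟩
    rw [mem_arr, Fin.sum_univ_succ] at hJX
    rw [Finset.sdiff_val, ← hJX, ← h0, add_tsub_cancel_left]
    rfl
  · rintro ⟨L, J⟩ hLJ
    rw [Finset.mem_product, mem_arrL, mem_arr] at hLJ
    rw [Finset.mem_filter, mem_arr, Fin.sum_univ_succ]
    simp only [Fin.cons_zero, Fin.cons_succ]
    refine ⟨?_, ?_⟩
    · rw [hLJ.1, hLJ.2, Finset.sdiff_val]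
      exact add_tsub_cancel_of_le (Finset.val_le_iff.2 (Finset.mem_powerset.1 hY))
    · ext i
      rw [List.mem_toFinset, ← Finset.mem_val, ← hLJ.1, Multiset.mem_coe]
  · intro J _
    exact Fin.cons_self_tail J
  · rintro ⟨L, J⟩ _
    simp
  · intro J _
    rw [Fin.cons_self_tail]

theorem formProd_apply {m : ℕ} (f : Fin m → List ι → RatFn ι n) (X : Finset ι) :
    formProd (fun μ Y => ∑ L ∈ arrL Y, f μ L) X = ∑ J ∈ arr m X, ∏ μ, f μ (J μ) := by
  induction m generalizing X with
  | zero =>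
    simp only [formProd, List.ofFn_zero, List.foldr_nil, formOne, Finset.univ_eq_empty,
      Finset.prod_empty]
    split_ifs with hX
    · subst hX
      have : arr 0 (∅ : Finset ι) = {fun _ => []} := by
        ext J
        rw [mem_arr, Finset.mem_singleton]
        simp [eq_iff_true_of_subsingleton]
      simp [this]
    · refine (Finset.sum_eq_zero fun J hJ => ?_).symm
      rw [mem_arr] at hJ
      exact absurd (Finset.val_eq_zero.1 (by simpa using hJ.symm)) hX
  | succ m ih =>
    have h1 : formProd (fun μ Y => ∑ L ∈ arrL Y, f μ L) = formMul (fun Y => ∑ L ∈ arrL Y, f 0 L)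
        (formProd fun (μ : Fin m) Y => ∑ L ∈ arrL Y, f μ.succ L) := by
      rw [formProd, List.ofFn_succ, List.foldr_cons, formProd]
    rw [h1, formMul, sum_arr_succ]
    refine Finset.sum_congr rfl fun Y _ => ?_
    rw [ih, Finset.sum_mul]
    refine Finset.sum_congr rfl fun L _ => ?_
    rw [Finset.mul_sum]
    refine Finset.sum_congr rfl fun J _ => ?_
    rw [Fin.prod_univ_succ]
    simp

theorem formProd_wordForm (π : ι → Fin r) (w : Fin n → List (Fin r) → ℂ) :
    formProd (fun ν => wordForm π ν (w ν)) = tupleForm n π (pureFn w) := by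
  funext X
  rw [tupleForm_pureFn]
  exact formProd_apply (fun ν L => algebraMap ℂ _ (w ν (L.map π)) * zetaSeq ν L) X

theorem tensorV_le_span (A : Matrix (Fin r) (Fin r) ℤ) (π : ι → Fin r) (lam : Fin n → Fin r → ℝ) :
    tensorV A π lam ≤ Submodule.span ℂ {η | ∃ w : Fin n → List (Fin r) → ℂ,
      (∀ ν, w ν ∈ hwMod A fun k => (lam ν k : ℂ)) ∧ η = tupleForm n π (pureFn w)} := by
  refine Submodule.span_mono ?_
  rintro _ ⟨ω, hω, rfl⟩
  choose w hw hwω using fun ν => factorV_le A π (lam ν) ν (hω ν)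
  refine ⟨w, hw, ?_⟩
  rw [← formProd_wordForm]
  congr 1
  funext ν
  exact (hwω ν).symm

/-! #### Finiteness of supports -/

theorem insOp_eq_zero_of_length (A : Matrix (Fin r) (Fin r) ℤ) (lam : Fin r → ℂ) (k : Fin r)
    {m : ℕ} {w : List (Fin r) → ℂ} (hw : ∀ S : List (Fin r), S.length = m → w S = 0)
    {S : List (Fin r)} (hS : S.length = m + 1) : insOp A lam k w S = 0 := by
  induction S generalizing m w with
  | nil => rfl
  | cons s S ih =>
    have hS' : S.length = m := by simpa using hS
    have h1 : insOp A lam k (delOp s w) S = 0 := by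
      cases S with
      | nil => rfl
      | cons s' S =>
        refine ih (m := S.length) (fun T hT => hw _ ?_) (by simp)
        rw [List.length_cons, hT, ← hS', List.length_cons]
    rw [insOp_cons, h1, hw S hS']
    simp

theorem exists_length_bound (A : Matrix (Fin r) (Fin r) ℤ) (lam : Fin r → ℂ) :
    ∀ {w : List (Fin r) → ℂ}, w ∈ hwMod A lam →
      ∃ N, ∀ S : List (Fin r), N ≤ S.length → w S = 0 := by
  let W : Submodule ℂ (List (Fin r) → ℂ) :=
    { carrier := {w | ∃ N, ∀ S : List (Fin r), N ≤ S.length → w S = 0}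
      zero_mem' := ⟨0, fun _ _ => rfl⟩
      add_mem' := by
        rintro v w ⟨N, hN⟩ ⟨N', hN'⟩
        refine ⟨max N N', fun S hS => ?_⟩
        rw [Pi.add_apply, hN S (le_trans (le_max_left _ _) hS),
          hN' S (le_trans (le_max_right _ _) hS), add_zero]
      smul_mem' := by
        rintro c w ⟨N, hN⟩
        exact ⟨N, fun S hS => by rw [Pi.smul_apply, hN S hS, smul_zero]⟩ }
  have hle : hwMod A lam ≤ W := by
    refine hwMod_le A lam ⟨1, fun S hS => ?_⟩ ?_
    · exact if_neg (List.length_pos_iff.1 hS)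
    · rintro k w - ⟨N, hN⟩
      refine ⟨N + 1, fun S hS => insOp_eq_zero_of_length A lam k (m := S.length - 1)
        (fun T hT => hN T (by omega)) (by omega)⟩
  exact fun {w} hw => hle hw

/-- Each f_k lengthens words by one letter, so elements of the module live on words of bounded
length. Their products are therefore finite combinations of the ζ(S), which gives V ⊂ Ṽ. -/
theorem finite_support_pureFn (A : Matrix (Fin r) (Fin r) ℤ) (lam : Fin n → Fin r → ℂ)
    {w : Fin n → List (Fin r) → ℂ} (hw : ∀ ν, w ν ∈ hwMod A (lam ν)) :
    (Function.support (pureFn w)).Finite := by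
  choose N hN using fun ν => exists_length_bound A (lam ν) (hw ν)
  refine (Set.Finite.pi' fun ν => List.finite_length_lt (Fin r) (N ν)).subset fun S hS ν => ?_
  by_contra h
  refine hS (Finset.prod_eq_zero (Finset.mem_univ ν) (hN ν _ ?_))
  simpa using h

/-! #### Coordinates in `Ṽ` -/

theorem zetaSum_eq_tupleForm (π : ι → Fin r) (S : Fin n → List (Fin r)) :
    zetaSum π S = tupleForm n π (Pi.single S 1) := by
  funext X
  rw [tupleForm_apply, zetaSum]
  have h1 : (finite_seqTuples π S X).toFinset = (arr n X).filter fun J =>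
      (fun ν => (J ν).map π) = S := by
    ext J
    rw [Set.Finite.mem_toFinset, Finset.mem_filter, mem_arr, seqTuples, Set.mem_ofPred_eq,
      funext_iff, and_comm]
  rw [h1, Finset.sum_filter]
  refine Finset.sum_congr rfl fun J _ => ?_
  rw [Pi.single_apply]
  split_ifs <;> simp

variable {π : ι → Fin r} (hπ : ∀ k, (π ⁻¹' {k}).Infinite)

/-- The coordinates of the elements of `Ṽ`, as functions of tuples of words. -/
def tildeCoord (n : ℕ) : tildeV ι n π →ₗ[ℂ] (Fin n → List (Fin r)) → ℂ :=
  Finsupp.lcoeFun ∘ₗ (zetaBasis n hπ).repr.toLinearMap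

theorem tildeCoord_zetaBasis (S : Fin n → List (Fin r)) :
    tildeCoord hπ n (zetaBasis n hπ S) = Pi.single S 1 := by
  simp [tildeCoord, Finsupp.lcoeFun, Finsupp.single_eq_pi_single]

theorem tupleForm_tildeCoord (u : tildeV ι n π) : tupleForm n π (tildeCoord hπ n u) = u := by
  have : tupleForm n π ∘ₗ tildeCoord hπ n = (tildeV ι n π).subtype := by
    refine (zetaBasis n hπ).ext fun S => ?_
    rw [LinearMap.comp_apply, tildeCoord_zetaBasis, ← zetaSum_eq_tupleForm, ← coe_zetaBasis hπ]
    rfl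
  exact LinearMap.congr_fun this u

theorem exists_tildeCoord_eq {g : (Fin n → List (Fin r)) → ℂ} (hg : (Function.support g).Finite) :
    ∃ u : tildeV ι n π, tildeCoord hπ n u = g := by
  refine ⟨(zetaBasis n hπ).repr.symm (Finsupp.ofSupportFinite g hg), ?_⟩
  simp [tildeCoord, Finsupp.lcoeFun, Finsupp.ofSupportFinite_coe]

/-- The operator `e_k` in the `ν`-th factor, on functions of tuples of words. -/
def factorDel (ν : Fin n) (k : Fin r) : Module.End ℂ ((Fin n → List (Fin r)) → ℂ) :=
  LinearMap.funLeft ℂ ℂ fun S => Function.update S ν (k :: S ν)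

theorem factorDel_apply (ν : Fin n) (k : Fin r) (g : (Fin n → List (Fin r)) → ℂ)
    (S : Fin n → List (Fin r)) : factorDel ν k g S = g (Function.update S ν (k :: S ν)) := rfl

/-- Deleting a first letter k from basis vectors is, on coordinates, evaluation at words with k put
in front. -/
theorem tildeCoord_eOp (k : Fin r) (u : tildeV ι n π) :
    tildeCoord hπ n (eOp n hπ k u) = (∑ ν, factorDel ν k) (tildeCoord hπ n u) := by
  have : tildeCoord hπ n ∘ₗ eOp n hπ k = (∑ ν, factorDel ν k) ∘ₗ tildeCoord hπ n := by
    refine (zetaBasis n hπ).ext fun S => ?_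
    rw [LinearMap.comp_apply, LinearMap.comp_apply, eOp_zetaBasis, tildeCoord_zetaBasis, map_sum,
      LinearMap.sum_apply]
    refine Finset.sum_congr rfl fun ν _ => ?_
    funext T
    rw [factorDel_apply, Pi.single_apply]
    split_ifs with h h' h'
    · rw [tildeCoord_zetaBasis, ← h', Function.update_self, List.tail_cons, Function.update_idem,
        Function.update_eq_self, Pi.single_eq_same]
    · rw [tildeCoord_zetaBasis, Pi.single_apply, if_neg]
      rintro rfl
      refine h' ?_
      rw [Function.update_self, Function.update_idem]
      obtain ⟨L, hL⟩ : ∃ L, S ν = k :: L := by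
        cases hS : S ν with
        | nil => simp [hS] at h
        | cons s L => exact ⟨L, by simpa [hS] using h⟩
      rw [hL, List.tail_cons, ← hL, Function.update_eq_self]
    · rw [← h', Function.update_self] at h
      simp at h
    · simp
  exact LinearMap.congr_fun this u

theorem factorDel_comm {ν μ : Fin n} (h : ν ≠ μ) (k l : Fin r) :
    Commute (factorDel ν k) (factorDel μ l) := by
  refine LinearMap.ext fun g => funext fun S => ?_
  simp only [Module.End.mul_apply, factorDel_apply]
  rw [Function.update_of_ne h.symm, Function.update_of_ne h, Function.update_comm h]

theorem Commute.iterBracket_right {R K : Type*} [Ring R] {a : R} {x : K → R}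
    (h : ∀ k, Commute a (x k)) (S : List K) : Commute a (iterBracket x S) := by
  induction S with
  | nil => exact Commute.zero_right a
  | cons s S ih =>
    cases S with
    | nil => exact h s
    | cons s' S => exact ((h s).mul_right ih).sub_right (ih.mul_right (h s))

/-- Operators in different factors commute, so every mixed term of the bracket cancels. -/
theorem iterBracket_sum {R K : Type*} [Ring R] {m : ℕ} (x : Fin m → K → R)
    (h : ∀ ν μ, ν ≠ μ → ∀ k l, Commute (x ν k) (x μ l)) (S : List K) :
    iterBracket (fun k => ∑ ν, x ν k) S = ∑ ν, iterBracket (x ν) S := by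
  induction S with
  | nil => simp [iterBracket]
  | cons s S ih =>
    cases S with
    | nil => simp [iterBracket]
    | cons s' S =>
      simp only [iterBracket]
      rw [ih, Finset.sum_mul_sum, Finset.sum_mul_sum, Finset.sum_comm, ← Finset.sum_sub_distrib]
      refine Finset.sum_congr rfl fun μ _ => ?_
      rw [← Finset.sum_sub_distrib, Finset.sum_eq_single μ]
      · intro ν _ hne
        rw [sub_eq_zero]
        exact (Commute.iterBracket_right (h ν μ hne s) _)
      · simp

theorem tildeCoord_eBracket (S : List (Fin r)) (u : tildeV ι n π) :
    tildeCoord hπ n (eBracket n hπ S u) =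
      ∑ ν, iterBracket (factorDel ν) S.reverse (tildeCoord hπ n u) := by
  rw [eBracket, iterBracket_intertwine (eOp n hπ) (fun k => ∑ ν, factorDel ν k) (tildeCoord hπ n)
    (tildeCoord_eOp hπ), iterBracket_sum _ fun ν μ h k l => factorDel_comm h k l,
    LinearMap.sum_apply]

theorem iterBracket_factorDel_pureFn (ν : Fin n) (S : List (Fin r))
    (w : Fin n → List (Fin r) → ℂ) : iterBracket (factorDel ν) S (pureFn w) =
      pureFn (Function.update w ν (iterBracket delOp S (w ν))) := by
  let φ : (List (Fin r) → ℂ) →ₗ[ℂ] (Fin n → List (Fin r)) → ℂ :=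
    { toFun v := pureFn (Function.update w ν v)
      map_add' u v := by
        funext T
        simp only [pureFn, Pi.add_apply, ← Finset.mul_prod_erase _ _ (Finset.mem_univ ν),
          Function.update_self, add_mul]
        congr 2 <;>
        · refine Finset.prod_congr rfl fun μ hμ => ?_
          simp only [Function.update_of_ne (Finset.ne_of_mem_erase hμ)]
      map_smul' c v := by
        funext T
        simp only [pureFn, Pi.smul_apply, ← Finset.mul_prod_erase _ _ (Finset.mem_univ ν),
          Function.update_self, smul_eq_mul, RingHom.id_apply, mul_assoc]
        congr 2
        refine Finset.prod_congr rfl fun μ hμ => ?_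
        simp only [Function.update_of_ne (Finset.ne_of_mem_erase hμ)] }
  have h := iterBracket_intertwine delOp (factorDel ν) φ (fun k v => ?_) S (w ν)
  · have hφ : φ (w ν) = pureFn w := congrArg pureFn (Function.update_eq_self ν w)
    rw [hφ] at h
    exact h.symm
  · funext T
    change pureFn _ T = pureFn _ _
    simp only [pureFn]
    refine Finset.prod_congr rfl fun μ _ => ?_
    by_cases hμ : μ = ν
    · subst hμ
      simp [delOp_apply]
    · simp [Function.update_of_ne hμ]

end WordForms

/-! ### Iterated residues along a sequence whose bracket is central -/

section CentralBracket

variable {ι K : Type*} {n r : ℕ}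

/-- If Y_x commutes with the other operators, the coefficient does not depend on where x is
inserted. All numerators at the t_l vanish, and only the pole at z_ν is left. -/
theorem insD_runVal_of_comm (ν : Fin n) (x : ι) {Y : ι → Module.End ℂ (List K → ℂ)}
    {V : Submodule ℂ (List K → ℂ)} {L : List ι} (hV : ∀ l ∈ L, ∀ w ∈ V, Y l w ∈ V)
    (hc : ∀ l ∈ L, ∀ w ∈ V, Y x (Y l w) = Y l (Y x w)) {w : List K → ℂ} (hw : w ∈ V) :
    insD ν x (fun M => algebraMap ℂ (RatFn ι n) (runVal Y w M)) L =
      algebraMap ℂ _ (runVal Y (Y x w) L) * (tc x - zc ν)⁻¹ := by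
  induction L generalizing w with
  | nil => rfl
  | cons l L ih =>
    have h1 := ih (fun i hi => hV i (by simp [hi])) (fun i hi => hc i (by simp [hi]))
      (hV l (by simp) w hw)
    simp only [insD, runVal, hc l List.mem_cons_self w hw, sub_self, zero_mul, zero_add] at h1 ⊢
    exact h1

theorem opForm_insert_of_comm {x : ι} {Y : ι → Module.End ℂ (List K → ℂ)}
    {V : Fin n → Submodule ℂ (List K → ℂ)} {S : Finset ι} (hx : x ∉ S)
    (hV : ∀ ν, ∀ l ∈ S, ∀ w ∈ V ν, Y l w ∈ V ν)
    (hc : ∀ ν, ∀ l ∈ S, ∀ w ∈ V ν, Y x (Y l w) = Y l (Y x w)) {w : Fin n → List K → ℂ}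
    (hw : ∀ ν, w ν ∈ V ν) :
    opForm Y w (insert x S) =
      ∑ ν, (tc x - zc ν)⁻¹ * opForm Y (Function.update w ν (Y x (w ν))) S := by
  rw [opForm_insert Y w hx, Finset.sum_comm]
  refine Finset.sum_congr rfl fun ν _ => ?_
  rw [opForm, Finset.mul_sum]
  refine Finset.sum_congr rfl fun J hJ => ?_
  have hJS : ∀ l ∈ J ν, l ∈ S := fun l hl => (exists_mem_of_mem_arr hJ l).1 ⟨ν, hl⟩
  rw [insD_runVal_of_comm ν x (fun l hl => hV ν l (hJS l hl)) (fun l hl => hc ν l (hJS l hl))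
    (hw ν), ← Finset.mul_prod_erase _ _ (Finset.mem_univ ν), Function.update_self]
  rw [Finset.prod_congr rfl fun μ hμ => by
    rw [← Function.update_of_ne (Finset.ne_of_mem_erase hμ) (Y x (w ν)) w]]
  ring

theorem opForm_congr {X X' : ι → Module.End ℂ (List K → ℂ)} (w : Fin n → List K → ℂ)
    {S : Finset ι} (h : ∀ i ∈ S, X i = X' i) : opForm X w S = opForm X' w S := by
  refine Finset.sum_congr rfl fun J hJ => Finset.prod_congr rfl fun ν _ => ?_
  rw [runVal_congr (X' := X') (w ν) fun l hl => h l ((exists_mem_of_mem_arr hJ l).1 ⟨ν, hl⟩)]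

theorem iterBracket_map {R K' : Type*} [Ring R] (x : K → R) (f : K' → K) (S : List K') :
    iterBracket (fun i => x (f i)) S = iterBracket x (S.map f) := by
  induction S with
  | nil => rfl
  | cons s S ih =>
    cases S with
    | nil => rfl
    | cons s' S =>
      rw [iterBracket, ih]
      rfl

/-- The iterated residue of the form of a product of functions in highest weight modules on which
the bracket `[e_{i_1}, [… , e_{i_N}]]` commutes with all `e_k`. -/
theorem formResSeq_pureFn (A : Matrix (Fin r) (Fin r) ℤ) (π : ι → Fin r) (lam : Fin n → Fin r → ℂ)
    {I : List ι} (hI : I ≠ []) (hnd : I.Nodup)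
    (hc : ∀ ν k, ∀ w ∈ hwMod A (lam ν), iterBracket delOp (I.map π).reverse (delOp k w) =
      delOp k (iterBracket delOp (I.map π).reverse w))
    {w : Fin n → List (Fin r) → ℂ} (hw : ∀ ν, w ν ∈ hwMod A (lam ν)) (S : Finset ι) :
    formResSeq I (tupleForm n π (pureFn w)) S = if ∀ i ∈ I.dropLast, i ∉ S then
      if I.getLast hI ∈ S then ∑ ν, (tc (I.getLast hI) - zc ν)⁻¹ *
        tupleForm n π (iterBracket (factorDel ν) (I.map π).reverse (pureFn w))
          (S.erase (I.getLast hI))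
      else if I.length = 1 then tupleForm n π (pureFn w) S else 0 else 0 := by
  rw [← opForm_delOp, formResSeq_opForm hI hnd]
  by_cases hS : ∀ i ∈ I.dropLast, i ∉ S
  swap
  · rw [if_neg hS, if_neg hS]
  rw [if_pos hS, if_pos hS]
  by_cases hlast : I.getLast hI ∈ S
  swap
  · rw [if_neg hlast, if_neg hlast]
  rw [if_pos hlast, if_pos hlast]
  set x := I.getLast hI with hx
  set Y := chainOps I fun i => delOp (π i) with hY
  -- After the residues the surviving index carries the whole bracket, while every other index of
  -- `S` lies outside `I` and still carries its e_k.
  have hYx : Y x = iterBracket delOp (I.map π).reverse := by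
    rw [hY, hx, chainOps_getLast hI hnd, iterBracket_map, List.map_reverse]
  have hnotMem : ∀ i ∈ S.erase x, i ∉ I := by
    intro i hi hiI
    rw [← List.dropLast_append_getLast hI, List.mem_append, List.mem_singleton] at hiI
    rcases hiI with h | h
    · exact hS i h (Finset.mem_of_mem_erase hi)
    · exact Finset.ne_of_mem_erase hi h
  have hYl : ∀ l ∈ S.erase x, Y l = delOp (π l) := fun l hl =>
    chainOps_of_notMem (hnotMem l hl) _
  obtain ⟨T, hxT, hT⟩ : ∃ T, x ∉ T ∧ insert x T = S :=
    ⟨S.erase x, by simp, Finset.insert_erase hlast⟩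
  have hTe : S.erase x = T := by rw [← hT, Finset.erase_insert hxT]
  rw [hTe] at hYl ⊢
  rw [← hT, opForm_insert_of_comm (V := fun ν => hwMod A (lam ν)) hxT _ _ hw]
  · refine Finset.sum_congr rfl fun ν _ => ?_
    rw [opForm_congr _ hYl, opForm_delOp, hYx, ← iterBracket_factorDel_pureFn]
  · intro ν l hl v hv
    rw [hYl l hl]
    exact delOp_mem A (lam ν) _ hv
  · intro ν l hl v hv
    rw [hYl l hl, hYx]
    exact hc ν (π l) v hv

/-- The iterated residue as a linear map. -/
def formResSeqLin : List ι → Form ι n →ₗ[ℂ] Form ι n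
  | [] => LinearMap.id
  | [_] => LinearMap.id
  | i :: j :: I => formResSeqLin (j :: I) ∘ₗ
    LinearMap.pi fun X => if i ∈ X then 0 else resLin i (tc j) ∘ₗ LinearMap.proj (insert i X)

theorem formResSeqLin_apply (I : List ι) (ω : Form ι n) :
    formResSeqLin I ω = formResSeq I ω := by
  induction I generalizing ω with
  | nil => rfl
  | cons i I ih =>
    cases I with
    | nil => rfl
    | cons j I =>
      rw [formResSeqLin, LinearMap.comp_apply, ih, formResSeq]
      congr 1
      funext X
      rw [LinearMap.pi_apply, formRes]
      split_ifs <;> rfl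

theorem formResSeq_append {J : List ι} (hJ : J ≠ []) (J' : List ι) (ω : Form ι n) :
    formResSeq (J ++ J') ω = formResSeq (J.getLast hJ :: J') (formResSeq J ω) := by
  induction J generalizing ω with
  | nil => exact absurd rfl hJ
  | cons i J ih =>
    cases J with
    | nil => rfl
    | cons j J =>
      rw [List.getLast_cons (List.cons_ne_nil j J), List.cons_append, List.cons_append, formResSeq,
        ← List.cons_append, ih (List.cons_ne_nil j J), formResSeq]

/-- The iterated residue of the elements of `V(λ_1, …, λ_n)` in a direction whose bracket commutes
with all `e_k`. -/
theorem formResSeq_tensorV (A : Matrix (Fin r) (Fin r) ℤ) {π : ι → Fin r}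
    (hπ : ∀ k, (π ⁻¹' {k}).Infinite) (lam : Fin n → Fin r → ℝ) {I : List ι} (hI : I ≠ [])
    (hnd : I.Nodup) (hc : ∀ (lam : Fin r → ℂ) k, ∀ w ∈ hwMod A lam,
      iterBracket delOp (I.map π).reverse (delOp k w) =
        delOp k (iterBracket delOp (I.map π).reverse w))
    {ζ : Form ι n} (hζ : ζ ∈ tensorV A π lam) :
    ∃ u : tildeV ι n π, (u : Form ι n) = ζ ∧ ∀ S : Finset ι,
      formResSeq I u S = if ∀ i ∈ I.dropLast, i ∉ S then
        if I.getLast hI ∈ S then ∑ ν, (tc (I.getLast hI) - zc ν)⁻¹ *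
          tupleForm n π (iterBracket (factorDel ν) (I.map π).reverse (tildeCoord hπ n u))
            (S.erase (I.getLast hI))
        else if I.length = 1 then (u : Form ι n) S else 0 else 0 := by
  -- The formula is linear in u, so it extends from pure products to the span; producing u as an
  -- element of Ṽ proves the inclusion V ⊂ Ṽ along the way.
  refine Submodule.span_induction (p := fun ζ _ => ∃ u : tildeV ι n π, (u : Form ι n) = ζ ∧
    ∀ S : Finset ι, formResSeq I u S = if ∀ i ∈ I.dropLast, i ∉ S then
        if I.getLast hI ∈ S then ∑ ν, (tc (I.getLast hI) - zc ν)⁻¹ *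
          tupleForm n π (iterBracket (factorDel ν) (I.map π).reverse (tildeCoord hπ n u))
            (S.erase (I.getLast hI))
        else if I.length = 1 then (u : Form ι n) S else 0 else 0) ?_ ?_ ?_ ?_
      (tensorV_le_span A π lam hζ)
  · rintro _ ⟨w, hw, rfl⟩
    obtain ⟨u, hu⟩ := exists_tildeCoord_eq hπ (finite_support_pureFn A _ hw)
    have h1 : tupleForm n π (pureFn w) = u := by rw [← hu, tupleForm_tildeCoord]
    refine ⟨u, h1.symm, fun S => ?_⟩
    rw [← h1, formResSeq_pureFn A π (fun ν k => (lam ν k : ℂ)) hI hnd (fun ν => hc _) hw, ← hu]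
  · refine ⟨0, rfl, fun S => ?_⟩
    rw [← formResSeqLin_apply]
    simp
  · rintro _ _ - - ⟨u, rfl, h1⟩ ⟨v, rfl, h2⟩
    refine ⟨u + v, rfl, fun S => ?_⟩
    rw [Submodule.coe_add, ← formResSeqLin_apply, map_add, Pi.add_apply, formResSeqLin_apply,
      formResSeqLin_apply, h1 S, h2 S]
    split_ifs <;> simp [mul_add, Finset.sum_add_distrib]
  · rintro c _ - ⟨u, rfl, h1⟩
    refine ⟨c • u, rfl, fun S => ?_⟩
    rw [Submodule.coe_smul, ← formResSeqLin_apply, map_smul, Pi.smul_apply, formResSeqLin_apply,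
      h1 S]
    split_ifs <;> simp [Finset.smul_sum]

/-- The bracket acts by zero in each factor, so it trivially commutes with the e_k and the formula
for a commuting bracket applies with all terms zero. Simple roots being roots rules out length one,
where nothing would be killed. -/
theorem formResSeq_tensorV_eq_zero (A : Matrix (Fin r) (Fin r) ℤ) (hA : IsGCM A) (π : ι → Fin r)
    (lam : Fin n → Fin r → ℝ) {I : List ι} (hI : I ≠ []) (hnd : I.Nodup)
    (hroot : ¬ IsRoot A (rootSum (I.map π))) {ζ : Form ι n} (hζ : ζ ∈ tensorV A π lam) :
    formResSeq I ζ = 0 := by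
  have h1 : I.length ≠ 1 := by
    intro h
    obtain ⟨i, rfl⟩ := List.length_eq_one_iff.1 h
    refine hroot ?_
    rw [show rootSum ([i].map π) = simpleRoot (π i) by simp [rootSum]]
    exact isRoot_simpleRoot A hA _
  have h0 : ∀ (lam : Fin r → ℂ), ∀ w ∈ hwMod A lam,
      iterBracket delOp (I.map π).reverse w = 0 := fun lam w hw =>
    iterBracket_delOp_eq_zero A lam hA (rootSum_ne_zero (by simpa using hI))
      (by rwa [rootSum_reverse]) hw
  have hker : tensorV A π lam ≤ LinearMap.ker (formResSeqLin I) := by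
    refine (tensorV_le_span A π lam).trans (Submodule.span_le.2 ?_)
    rintro _ ⟨w, hw, rfl⟩
    rw [SetLike.mem_coe, LinearMap.mem_ker, formResSeqLin_apply]
    funext S
    rw [formResSeq_pureFn A π (fun ν k => (lam ν k : ℂ)) hI hnd _ hw, if_neg h1]
    · have h2 : ∀ ν, iterBracket (factorDel ν) (I.map π).reverse (pureFn w) = 0 := by
        intro ν
        rw [iterBracket_factorDel_pureFn, h0 _ _ (hw ν)]
        funext T
        exact Finset.prod_eq_zero (Finset.mem_univ ν) (by simp)
      simp [h2]
    · intro ν k v hv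
      rw [h0 _ _ hv, h0 _ _ (delOp_mem A _ k hv), map_zero]
  rw [← formResSeqLin_apply]
  exact hker hζ

end CentralBracket

/-! ### Poles -/

section Poles

variable {ι : Type*} {n r : ℕ}

theorem tupleForm_mem_noVar (π : ι → Fin r) (g : (Fin n → List (Fin r)) → ℂ) {x : ι}
    {S : Finset ι} (hx : x ∉ S) : tupleForm n π g S ∈ noVar n x :=
  sum_mem fun _ hJ => mul_mem (algebraMap_mem_noVar _ _)
    (prod_mem fun ν _ => zetaSeq_mem_noVar ν (notMem_of_mem_arr hJ hx ν))

theorem exists_fraction_of_mem_noVar {x : ι} {g : RatFn ι n} (hg : g ∈ noVar n x) :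
    ∃ p q : Poly ι n, p.degreeOf (Sum.inl x) = 0 ∧ q.degreeOf (Sum.inl x) = 0 ∧ q ≠ 0 ∧
      g * algebraMap (Poly ι n) (RatFn ι n) q = algebraMap _ _ p := by
  have hmul : ∀ {p q : Poly ι n}, p.degreeOf (Sum.inl x) = 0 → q.degreeOf (Sum.inl x) = 0 →
      (p * q).degreeOf (Sum.inl x) = 0 := fun {p q} hp hq => by
    have := MvPolynomial.degreeOf_mul_le (Sum.inl x) p q
    omega
  have hadd : ∀ {p q : Poly ι n}, p.degreeOf (Sum.inl x) = 0 → q.degreeOf (Sum.inl x) = 0 →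
      (p + q).degreeOf (Sum.inl x) = 0 := fun {p q} hp hq => by
    have := MvPolynomial.degreeOf_add_le (Sum.inl x) p q
    omega
  induction hg using Subfield.closure_induction with
  | mem g hg =>
    rcases hg with ⟨c, rfl⟩ | ⟨j, hj, rfl⟩
    · exact ⟨MvPolynomial.C c, 1, by simp, by simp, one_ne_zero, by rw [map_one, mul_one]; rfl⟩
    · exact ⟨MvPolynomial.X j, 1, MvPolynomial.degreeOf_X_of_ne hj.symm, by simp, one_ne_zero,
        by rw [map_one, mul_one]; rfl⟩
  | one => exact ⟨1, 1, by simp, by simp, one_ne_zero, by simp⟩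
  | add g h _ _ hg hh =>
    obtain ⟨p, q, hp, hq, hq0, hpq⟩ := hg
    obtain ⟨p', q', hp', hq', hq0', hpq'⟩ := hh
    refine ⟨p * q' + p' * q, q * q', hadd (hmul hp hq') (hmul hp' hq), hmul hq hq',
      mul_ne_zero hq0 hq0', ?_⟩
    simp only [map_mul, map_add]
    rw [← hpq, ← hpq']
    ring
  | neg g _ hg =>
    obtain ⟨p, q, hp, hq, hq0, hpq⟩ := hg
    exact ⟨-p, q, by rwa [MvPolynomial.degreeOf_neg], hq, hq0, by rw [map_neg, ← hpq]; ring⟩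
  | inv g _ hg =>
    obtain ⟨p, q, hp, hq, hq0, hpq⟩ := hg
    by_cases hg0 : g = 0
    · exact ⟨0, 1, by simp, by simp, one_ne_zero, by simp [hg0]⟩
    · refine ⟨q, p, hq, hp, ?_, by rw [← hpq, inv_mul_cancel_left₀ hg0]⟩
      rintro rfl
      rw [map_zero, mul_eq_zero] at hpq
      refine hpq.elim hg0 fun h => hq0 ?_
      exact IsFractionRing.injective (Poly ι n) (RatFn ι n) (by rw [h, map_zero])
  | mul g h _ _ hg hh =>
    obtain ⟨p, q, hp, hq, hq0, hpq⟩ := hg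
    obtain ⟨p', q', hp', hq', hq0', hpq'⟩ := hh
    refine ⟨p * p', q * q', hmul hp hp', hmul hq hq', mul_ne_zero hq0 hq0', ?_⟩
    simp only [map_mul]
    rw [← hpq, ← hpq']
    ring

/-- A denominator free of t_x has degree 0 in it. Degrees add in products, so it is not divisible by
a polynomial that involves t_x. -/
theorem not_hasPoleAlong_of_mem_noVar {x : ι} {P : Poly ι n} (hx : Sum.inl x ∈ P.vars)
    {g : RatFn ι n} (hg : g ∈ noVar n x) : ¬ HasPoleAlong P g := by
  obtain ⟨p, q, -, hq, hq0, hpq⟩ := exists_fraction_of_mem_noVar hg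
  refine not_not.2 ⟨p, q, ?_, hpq⟩
  rintro ⟨R, rfl⟩
  rw [MvPolynomial.degreeOf_mul_eq (left_ne_zero_of_mul hq0) (right_ne_zero_of_mul hq0)] at hq
  have := MvPolynomial.mem_vars_iff_degreeOf_ne_zero.1 hx
  omega

theorem not_hasPoleAlong_mul {P : Poly ι n} (hP : Irreducible P) {g h : RatFn ι n}
    (hg : ¬ HasPoleAlong P g) (hh : ¬ HasPoleAlong P h) : ¬ HasPoleAlong P (g * h) := by
  obtain ⟨p, q, hq, hpq⟩ := not_not.1 hg
  obtain ⟨p', q', hq', hpq'⟩ := not_not.1 hh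
  refine not_not.2 ⟨p * p', q * q', fun hd => (hP.prime.dvd_or_dvd hd).elim hq hq', ?_⟩
  simp only [map_mul]
  rw [← hpq, ← hpq']
  ring

theorem not_hasPoleAlong_add {P : Poly ι n} (hP : Irreducible P) {g h : RatFn ι n}
    (hg : ¬ HasPoleAlong P g) (hh : ¬ HasPoleAlong P h) : ¬ HasPoleAlong P (g + h) := by
  obtain ⟨p, q, hq, hpq⟩ := not_not.1 hg
  obtain ⟨p', q', hq', hpq'⟩ := not_not.1 hh
  refine not_not.2 ⟨p * q' + p' * q, q * q', fun hd => (hP.prime.dvd_or_dvd hd).elim hq hq', ?_⟩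
  simp only [map_mul, map_add]
  rw [← hpq, ← hpq']
  ring

theorem not_hasPoleAlong_sum {α : Type*} {P : Poly ι n} (hP : Irreducible P) (T : Finset α)
    (g : α → RatFn ι n) (hg : ∀ i ∈ T, ¬ HasPoleAlong P (g i)) :
    ¬ HasPoleAlong P (∑ i ∈ T, g i) := by
  induction T using Finset.induction_on with
  | empty =>
    rw [Finset.sum_empty]
    exact not_not.2 ⟨0, 1, fun h => hP.not_isUnit (isUnit_of_dvd_one h), by simp⟩
  | insert i T hi ih =>
    rw [Finset.sum_insert hi]
    exact not_hasPoleAlong_add hP (hg i (by simp)) (ih fun j hj => hg j (by simp [hj]))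

theorem irreducible_X_inl_sub_X_inr (x : ι) (ν : Fin n) :
    Irreducible (MvPolynomial.X (Sum.inl x) - MvPolynomial.X (Sum.inr ν) : Poly ι n) := by
  have := MvPolynomial.irreducible_mul_X_add (R := ℂ) 1 (-MvPolynomial.X (Sum.inr ν))
    (Sum.inl x : ι ⊕ Fin n) one_ne_zero (by simp) (by simp [MvPolynomial.vars_neg])
    isRelPrime_one_left
  simpa [sub_eq_add_neg] using this

theorem not_hasPoleAlong_inv_sub {P : Poly ι n} (hP : Irreducible P) {x : ι} {ν : Fin n}
    (h : ¬ Associated P (MvPolynomial.X (Sum.inl x) - MvPolynomial.X (Sum.inr ν))) :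
    ¬ HasPoleAlong P ((tc x - zc ν)⁻¹ : RatFn ι n) := by
  refine not_not.2 ⟨1, MvPolynomial.X (Sum.inl x) - MvPolynomial.X (Sum.inr ν), fun hd => h ?_, ?_⟩
  · exact hP.associated_of_dvd (irreducible_X_inl_sub_X_inr x ν) hd
  · rw [map_sub, map_one]
    exact inv_mul_cancel₀ (coord_sub_ne_zero (by simp))

theorem expandInfty_coord_self (x : ι) :
    expandInfty x (coord (Sum.inl x) : RatFn ι n) = HahnSeries.single (-1 : ℤ) 1 := by
  rw [expandInfty, coord, expand_algebraMap]
  simp [substPoly]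

/-- With u = 1/t_x the function is u/(1 - z_ν u) = u + O(u²). -/
theorem coeff_expandInfty_inv_sub (x : ι) (ν : Fin n) {k : ℤ} (hk : k < 2) :
    (expandInfty x ((tc x - zc ν)⁻¹ : RatFn ι n)).coeff k = if k = 1 then 1 else 0 := by
  have hz : expandInfty x (zc ν : RatFn ι n) = HahnSeries.C (zc ν) :=
    expand_of_mem_noVar _ (coord_mem_noVar (by simp))
  have hreg : IsReg (1 - HahnSeries.single (1 : ℤ) (zc ν : RatFn ι n))⁻¹ (1 : RatFn ι n)⁻¹ := by
    refine IsReg.inv ⟨1 - PowerSeries.C (zc ν) * PowerSeries.X, ?_, by simp⟩ one_ne_zero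
    simp [HahnSeries.C_apply]
  have h1 : expandInfty x ((tc x - zc ν)⁻¹ : RatFn ι n) =
      HahnSeries.single (1 : ℤ) 1 * (1 - HahnSeries.single (1 : ℤ) (zc ν : RatFn ι n))⁻¹ := by
    rw [map_inv₀, map_sub, tc, expandInfty_coord_self, hz]
    have : (HahnSeries.single (-1 : ℤ) 1 - HahnSeries.C (zc ν) : LaurentSeries (RatFn ι n)) =
        HahnSeries.single (-1 : ℤ) 1 * (1 - HahnSeries.single (1 : ℤ) (zc ν)) := by
      rw [mul_sub, mul_one, HahnSeries.single_mul_single]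
      simp [HahnSeries.C_apply]
    rw [this, mul_inv, HahnSeries.inv_single]
    simp
  obtain ⟨p, hp, hp1⟩ := hreg
  rw [h1, hp, HahnSeries.coeff_single_mul, one_mul]
  have h2 := PowerSeries.coeff_coe p (k - 1)
  refine h2.trans ?_
  split_ifs with h3 h4 h4
  · omega
  · rfl
  · subst h4
    simpa using hp1
  · omega

theorem iterBracket_apply_eq_zero {K M : Type*} [AddCommGroup M] [Module ℂ M]
    {x : K → Module.End ℂ M} {m : M} (h : ∀ k, x k m = 0) (S : List K) :
    iterBracket x S m = 0 := by
  induction S with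
  | nil => rfl
  | cons s S ih =>
    cases S with
    | nil => exact h s
    | cons s' S => simp [iterBracket, ih, h]

end Poles

end Polydiff

open Polydiff in
theorem mainTheorem5 {r n : ℕ} (A : Matrix (Fin r) (Fin r) ℤ) (hA : Polydiff.IsGCM A)
    {ι : Type*} [Countable ι] (π : ι → Fin r) (hπ : ∀ k, (π ⁻¹' {k}).Infinite)
    (lam : Fin n → Fin r → ℝ) (hlam : ∀ ν k, 0 ≤ lam ν k) :
    (∀ I : List ι, I.Nodup →
      (∃ ζ ∈ Polydiff.tensorV A π lam, Polydiff.formResSeq I ζ ≠ 0) →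
      ∀ J : List ι, J ≠ [] → J <+: I → Polydiff.IsRoot A (Polydiff.rootSum (J.map π))) ∧
    (LieAlgebra.IsSimple ℂ (Polydiff.KM A) → FiniteDimensional ℂ (Polydiff.KM A) →
      ∀ (I : List ι) (hI : I ≠ []), I.Nodup →
      Polydiff.IsHighestRoot A (Polydiff.rootSum (I.map π)) →
      ∀ ζ ∈ Polydiff.tensorV A π lam,
        Polydiff.PolesOnlyAtInftyAndZ (I.getLast hI) (Polydiff.formResSeq I ζ) ∧
        (Polydiff.IsPrimitive hπ ζ →
          Polydiff.RegularAtInfty (I.getLast hI) (Polydiff.formResSeq I ζ)) ∧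
        ∃ hζ : ζ ∈ Polydiff.tildeV ι n π,
          Polydiff.formRestrict {i | i ∉ I}
              (Polydiff.eBracket n hπ (I.map π) ⟨ζ, hζ⟩ : Polydiff.tildeV ι n π) =
            ∑ ν : Fin n, Polydiff.formRes (I.getLast hI) (Polydiff.zc ν)
              (Polydiff.formResSeq I ζ)) := by
  constructor
  · rintro I hnd ⟨ζ, hζ, hne⟩ J hJ ⟨J', rfl⟩
    by_contra hroot
    refine hne ?_
    -- The residues along the initial part J are taken first, so their vanishing makes all of res_I
    -- vanish.
    rw [formResSeq_append hJ, formResSeq_tensorV_eq_zero A hA π lam hJ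
      (List.Nodup.of_append_left hnd) hroot hζ, ← formResSeqLin_apply, map_zero]
  · intro _ _ I hI hnd hroot ζ hζ
    obtain ⟨u, rfl, hres⟩ := formResSeq_tensorV A hπ lam hI hnd (fun lam k w hw =>
      iterBracket_delOp_comm A lam hA (by simpa using hI) k
        (by rw [rootSum_reverse]; exact hroot.2.2 k) hw) hζ
    set x := I.getLast hI with hx
    set a : Fin n → Finset ι → RatFn ι n := fun ν => tupleForm n π
      (iterBracket (factorDel ν) (I.map π).reverse (tildeCoord hπ n u)) with ha
    have haS : ∀ ν S, a ν (Finset.erase S x) ∈ noVar n x := fun ν S =>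
      tupleForm_mem_noVar π _ (by simp)
    have hsum : ∀ S, ∑ ν, a ν S = (eBracket n hπ (I.map π) u : Form ι n) S := by
      intro S
      rw [← tupleForm_tildeCoord hπ, tildeCoord_eBracket, map_sum, Finset.sum_apply]
    -- The three kinds of components: those with dt_x and simple poles at the z_ν, the zero ones,
    -- and those that do not involve t_x at all.
    have hcases : ∀ S, (x ∈ S ∧ formResSeq I (u : Form ι n) S = ∑ ν, (tc x - zc ν)⁻¹ * a ν (S.erase x)) ∨
        formResSeq I (u : Form ι n) S = 0 ∨ (x ∉ S ∧ formResSeq I (u : Form ι n) S ∈ noVar n x) := by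
      intro S
      rw [hres S]
      by_cases h1 : ∀ i ∈ I.dropLast, i ∉ S
      · by_cases h2 : x ∈ S
        · exact Or.inl ⟨h2, by rw [if_pos h1, if_pos h2]⟩
        · refine Or.inr (Or.inr ⟨h2, ?_⟩)
          rw [if_pos h1, if_neg h2]
          split_ifs
          · rw [← tupleForm_tildeCoord hπ]
            exact tupleForm_mem_noVar π _ h2
          · exact zero_mem _
      · exact Or.inr (Or.inl (if_neg h1))
    refine ⟨?_, ?_, u.2, ?_⟩
    · intro S P hP hxP hpole
      by_contra hass
      push Not at hass
      refine absurd hpole ?_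
      rcases hcases S with ⟨-, h⟩ | h | ⟨-, h⟩
      · rw [h]
        exact not_hasPoleAlong_sum hP _ _ fun ν _ => not_hasPoleAlong_mul hP
          (not_hasPoleAlong_inv_sub hP (hass ν)) (not_hasPoleAlong_of_mem_noVar hxP (haS ν S))
      · rw [h]
        exact not_hasPoleAlong_of_mem_noVar hxP (zero_mem _)
      · exact not_hasPoleAlong_of_mem_noVar hxP h
    · rintro ⟨hu, hprim⟩ S k hk
      rcases hcases S with ⟨hxS, h⟩ | h | ⟨hxS, h⟩
      · rw [if_pos hxS] at hk
        -- Vanishing to order two at infinity amounts to the vanishing of the coefficient of 1/t_x.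
        -- This is a component of e_α̃ ζ, an iterated commutator of operators that all kill ζ.
        have h0 : ∑ ν, a ν (S.erase x) = 0 := by
          rw [hsum, eBracket, iterBracket_apply_eq_zero hprim]
          rfl
        rw [h, map_sum, HahnSeries.coeff_sum]
        have h1 : ∀ ν ∈ (Finset.univ : Finset (Fin n)),
            (expandInfty x ((tc x - zc ν)⁻¹ * a ν (S.erase x))).coeff k =
              (if k = 1 then 1 else 0) * a ν (S.erase x) := by
          intro ν _
          rw [map_mul, expandInfty, expand_of_mem_noVar _ (haS ν S), mul_comm,
            HahnSeries.C_mul_eq_smul, HahnSeries.coeff_smul, smul_eq_mul, mul_comm]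
          congr 1
          exact coeff_expandInfty_inv_sub x ν hk
        rw [Finset.sum_congr rfl h1, ← Finset.mul_sum, h0, mul_zero]
      · rw [h, map_zero]
        rfl
      · rw [if_neg hxS] at hk
        rw [expandInfty, expand_of_mem_noVar _ h, HahnSeries.C_apply,
          HahnSeries.coeff_single_of_ne hk.ne]
    · funext S
      rw [formRestrict, Finset.sum_apply]
      simp only [formRes]
      by_cases hxS : x ∈ S
      · simp only [if_pos hxS, Finset.sum_const_zero]
        exact if_neg fun h => h hxS (List.getLast_mem hI)
      · simp only [if_neg hxS]
        -- If S meets `I` outside its last entry, the restriction removes the left side and the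
        -- iterated residue has no such component. Otherwise the residue at z_ν of the sum over all
        -- factors picks out the ν-th summand.
        by_cases hdrop : ∀ i ∈ I.dropLast, i ∉ S
        · have hsub : (S : Set ι) ⊆ {i | i ∉ I} := by
            intro i hi hiI
            rw [← List.dropLast_append_getLast hI, List.mem_append, List.mem_singleton] at hiI
            rcases hiI with h | rfl
            · exact hdrop i h hi
            · exact hxS hi
          have hdrop' : ∀ i ∈ I.dropLast, i ∉ insert x S := by
            intro i hi h
            rcases Finset.mem_insert.1 h with rfl | h
            · rw [← List.dropLast_append_getLast hI, ← hx] at hnd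
              exact (List.disjoint_of_nodup_append hnd) hi (by simp)
            · exact hdrop i hi h
          rw [if_pos hsub, ← hsum]
          refine Finset.sum_congr rfl fun ν _ => ?_
          rw [hres, if_pos hdrop', if_pos (Finset.mem_insert_self x S), Finset.erase_insert hxS,
            resFn_sum, Finset.sum_eq_single ν]
          · rw [mul_comm, resFn_mul_of_mem_noVar _ _ (tupleForm_mem_noVar π _ hxS), zc, tc,
              resFn_inv_sub _ (by simp), if_pos rfl, mul_one]
          · intro μ _ hne
            rw [mul_comm, resFn_mul_of_mem_noVar _ _ (tupleForm_mem_noVar π _ hxS), zc, tc, zc,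
              resFn_inv_sub _ (by simp), if_neg (by simpa using hne), mul_zero]
          · simp
        · have hsub : ¬ (S : Set ι) ⊆ {i | i ∉ I} := fun h => hdrop fun i hi hiS =>
            h hiS (List.dropLast_subset _ hi)
          rw [if_neg hsub]
          refine (Finset.sum_eq_zero fun ν _ => ?_).symm
          rw [hres, if_neg, resFn_zero]
          exact fun h => hdrop fun i hi hiS => h i hi (Finset.mem_insert_of_mem hiS)

end
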